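/- Let $d\in\mathbb N$, let $M_d$ be the space of real $d\times d$ matrices, $S_d^+$ the cone of symmetric positive semidefinite and $S_d^{++}$ that of symmetric positive definite $d\times d$ matrices, and $\langle x,y\rangle=\operatorname{tr}(xy)$. For $p\ge 0$ and $\omega,\sigma\in S_d^+$, the non-central Wishart distribution $\Gamma(p,\omega;\sigma)$ is, whenever it exists, the probability measure on $S_d^+$ with Laplace transform $$\int_{S_d^+}e^{-\langle u,\xi\rangle}\,\Gamma(p,\omega;\sigma)(d\xi)=\det(I+\sigma u)^{-p}\,e^{-\operatorname{tr}\left(u(I+\sigma u)^{-1}\omega\right)},\qquad u\in S_d^+ ,$$ and $F(p,\omega,\sigma,\cdot)$ denotes its density with respect to Lebesgue measure on the symmetric $d\times d$ matrices, when it has one. A Wishart process with parameters $p\ge 0$, $\alpha\in S_d^+$, $\beta\in M_d$ is a stochastically continuous, time-homogeneous Markov process $(X,\mathbb P_x)_{x\in S_d^+}$ on $S_d^+$ such that $$\mathbb E_x\left[e^{-\langle u,X_t\rangle}\right]=e^{-\phi(t,u)-\langle\psi(t,u),x\rangle},\qquad t\ge 0,\ x,u\in S_d^+,$$ for functions $\phi:\mathbb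 R_+\times S_d^+\to\mathbb R$ and $\psi:\mathbb R_+\times S_d^+\to S_d^+$ that satisfy, with the dot denoting $\partial/\partial t$, $$\dot\phi(t,u)=2p\,\langle\alpha,\psi(t,u)\rangle,\quad \phi(0,u)=0,$$ $$\dot\psi(t,u)=-2\psi(t,u)\,\alpha\,\psi(t,u)+\psi(t,u)\beta+\beta^\top\psi(t,u),\quad \psi(0,u)=u .$$ For $t\ge0$ and $x\in S_d^+$ put $\omega^\beta_t(x)=e^{\beta t}xe^{\beta^\top t}$ and $\sigma_t^\beta(x)=2\int_0^t\omega^\beta_s(x)\,ds$. **Proposition.** Let $(X,\mathbb P_x)_{x\in S_d^+}$ be a Wishart process with parameters $(p,\alpha,\beta)$, and suppose that $\alpha\ne 0$. Then for all $t>0$ and $x\in S_d^+$ the law of $X_t$ under $\mathbb P_x$ is $\Gamma(p,\omega_t^\beta(x);\sigma_t^\beta(\alpha))$; in particular this distribution exists. If moreover $\alpha\in S_d^{++}$ and $p>\frac{d-1}{2}$, then for all $t>0$ and $x\in S_d^+$ the law of $X_t$ under $\mathbb P_x$ is absolutely continuous with respect to Lebesgue measure, with density $$f_t(x,\xi)=F(p,\omega_t^\beta(x),\sigma_t^\beta(\alpha),\xi).$$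 -/

import Mathlib

open MeasureTheory ProbabilityTheory
open scoped NNReal ENNReal Matrix

/-- The product σ-algebra on the space of real `d × d` matrices. -/
instance matrixMeasurableSpace (d : ℕ) : MeasurableSpace (Matrix (Fin d) (Fin d) ℝ) :=
  inferInstanceAs (MeasurableSpace (Fin d → Fin d → ℝ))

/-- The product σ-algebra on matrices is the Borel σ-algebra. -/
instance matrixBorelSpace (d : ℕ) : BorelSpace (Matrix (Fin d) (Fin d) ℝ) :=
  inferInstanceAs (BorelSpace (Fin d → Fin d → ℝ))

/-- The cone `S_d^+` of real symmetric positive semidefinite `d × d` matrices, with the topology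
and the (Borel) σ-algebra inherited from the space of all `d × d` matrices. -/
abbrev PSDCone (d : ℕ) : Type := {x : Matrix (Fin d) (Fin d) ℝ // x.PosSemidef}

/-- The pairing `⟨x, y⟩ = tr (x y)` on `S_d^+`. -/
def PSDCone.pairing {d : ℕ} (x y : PSDCone d) : ℝ := (x.1 * y.1).trace

/-- The linear isometry of the Euclidean space with coordinates `(v_{ij})_{i ≤ j}` onto the space
of symmetric `d × d` matrices with scalar product `tr (x y)`: diagonal entries are `v_{ii}`,
off-diagonal ones are `v_{ij} / √2`. -/
noncomputable def symmetricOfCoords (d : ℕ) (v : {q : Fin d × Fin d // q.1 ≤ q.2} → ℝ) :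
    Matrix (Fin d) (Fin d) ℝ :=
  Matrix.of fun i j =>
    if i = j then v ⟨(i, i), le_refl i⟩
    else v ⟨(min i j, max i j), min_le_max⟩ / √2

/-- Lebesgue measure on `S_d^+`: the Lebesgue measure of the Euclidean space of symmetric matrices
(with scalar product `tr (x y)`), restricted to the cone. -/
noncomputable def lebesgueCone (d : ℕ) : Measure (PSDCone d) :=
  ((volume : Measure ({q : Fin d × Fin d // q.1 ≤ q.2} → ℝ)).map
    (symmetricOfCoords d)).comap Subtype.val

/-- `μ` is a probability measure on `S_d^+` with the Laplace transform that defines the non-central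
Wishart distribution `Γ(p, ω; σ)`. -/
structure IsNoncentralWishart {d : ℕ} (p : ℝ) (ω σ : PSDCone d) (μ : Measure (PSDCone d)) :
    Prop where
  isProbabilityMeasure : IsProbabilityMeasure μ
  laplace : ∀ u : PSDCone d,
    ∫ ξ, Real.exp (-(u.pairing ξ)) ∂μ =
      (1 + σ.1 * u.1).det ^ (-p) * Real.exp (-(u.1 * (1 + σ.1 * u.1)⁻¹ * ω.1).trace)

open Classical in
/-- The non-central Wishart distribution `Γ(p, ω; σ)`, the probability measure given by its Laplace
transform (the zero measure if there is no such probability measure). -/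
noncomputable def noncentralWishart {d : ℕ} (p : ℝ) (ω σ : PSDCone d) : Measure (PSDCone d) :=
  if h : ∃ μ, IsNoncentralWishart p ω σ μ then h.choose else 0

/-- `F(p, ω, σ, ξ)`, the density of `Γ(p, ω; σ)` with respect to Lebesgue measure on `S_d^+`
(in general: the density of its absolutely continuous part). -/
noncomputable def wishartDensity {d : ℕ} (p : ℝ) (ω σ : PSDCone d) (ξ : PSDCone d) : ℝ≥0∞ :=
  (noncentralWishart p ω σ).rnDeriv (lebesgueCone d) ξ

/-- `(X, P_x)_{x ∈ S}` is a time-homogeneous Markov process with state space `S`, with respect to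
the filtration `ℱ`. -/
structure IsMarkovProcess {S Ω : Type*} [MeasurableSpace S] [mΩ : MeasurableSpace Ω]
    (ℱ : Filtration ℝ≥0 mΩ) (X : ℝ≥0 → Ω → S) (P : S → Measure Ω) : Prop where
  isProbabilityMeasure : ∀ x, IsProbabilityMeasure (P x)
  adapted : ∀ t, Measurable[ℱ t] (X t)
  start : ∀ x, ∀ᵐ ω ∂(P x), X 0 ω = x
  measurable_transition : ∀ (t : ℝ≥0) (A : Set S), MeasurableSet A →
    Measurable fun x => P x (X t ⁻¹' A)
  markov : ∀ (x : S) (s t : ℝ≥0) (A : Set S), MeasurableSet A →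
    (P x)[(X (s + t) ⁻¹' A).indicator (fun _ => (1 : ℝ)) | ℱ s]
      =ᵐ[P x] fun ω => (P (X s ω)).real (X t ⁻¹' A)

/-- Stochastic continuity: the transition probabilities `P_x(X_t ∈ ·)` are weakly continuous
in `t`. -/
def IsStochasticallyContinuous {S Ω : Type*} [TopologicalSpace S] [MeasurableSpace Ω]
    (X : ℝ≥0 → Ω → S) (P : S → Measure Ω) : Prop :=
  ∀ (x : S) (f : BoundedContinuousFunction S ℝ), Continuous fun t => ∫ ω, f (X t ω) ∂(P x)

/-- `(X, P_x)` is an affine process on `S_d^+` with characteristic exponents `φ, ψ`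
(whose values at negative times are irrelevant). -/
structure IsAffineProcess {d : ℕ} {Ω : Type*} [mΩ : MeasurableSpace Ω]
    (ℱ : Filtration ℝ≥0 mΩ) (X : ℝ≥0 → Ω → PSDCone d) (P : PSDCone d → Measure Ω)
    (φ : ℝ → PSDCone d → ℝ) (ψ : ℝ → PSDCone d → PSDCone d) : Prop where
  markov : IsMarkovProcess ℱ X P
  stochasticallyContinuous : IsStochasticallyContinuous X P
  affine : ∀ (t : ℝ≥0) (x u : PSDCone d),
    ∫ ω, Real.exp (-(u.pairing (X t ω))) ∂(P x) = Real.exp (-φ t u - (ψ t u).pairing x)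

/-- `(X, P_x)` is a Wishart process on `S_d^+` with parameters `(p, α, β)`: an affine process whose
characteristic exponents solve the Riccati equations
`φ' = 2 p ⟨α, ψ⟩`, `φ(0, u) = 0`, `ψ' = -2 ψ α ψ + ψ β + βᵀ ψ`, `ψ(0, u) = u` on `[0, ∞)`
(the second one is written out entry by entry). -/
def IsWishartProcess {d : ℕ} {Ω : Type*} [mΩ : MeasurableSpace Ω]
    (ℱ : Filtration ℝ≥0 mΩ) (X : ℝ≥0 → Ω → PSDCone d) (P : PSDCone d → Measure Ω)
    (p : ℝ) (α : PSDCone d) (β : Matrix (Fin d) (Fin d) ℝ) : Prop :=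
  0 ≤ p ∧ ∃ (φ : ℝ → PSDCone d → ℝ) (ψ : ℝ → PSDCone d → PSDCone d),
    IsAffineProcess ℱ X P φ ψ ∧
    (∀ u, φ 0 u = 0) ∧
    (∀ u, ψ 0 u = u) ∧
    (∀ u, ∀ t ≥ (0 : ℝ),
      HasDerivWithinAt (fun s => φ s u) (2 * p * α.pairing (ψ t u)) (Set.Ici 0) t) ∧
    (∀ u, ∀ t ≥ (0 : ℝ), ∀ i j,
      HasDerivWithinAt (fun s => (ψ s u).1 i j)
        ((-(2 : ℝ) • ((ψ t u).1 * α.1 * (ψ t u).1) + (ψ t u).1 * β + βᵀ * (ψ t u).1) i j)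
        (Set.Ici 0) t)

/-- The flow `ω_t^β(x) = e^{β t} x e^{βᵀ t}` of the vector field `β x + x βᵀ` on `S_d^+`. -/
noncomputable def wishartFlow {d : ℕ} (β : Matrix (Fin d) (Fin d) ℝ) (t : ℝ) (x : PSDCone d) :
    PSDCone d :=
  ⟨NormedSpace.exp (t • β) * x.1 * NormedSpace.exp (t • βᵀ), by
    have h := x.2.mul_mul_conjTranspose_same (NormedSpace.exp (t • β))
    rwa [← Matrix.exp_conjTranspose, Matrix.conjTranspose_smul, star_trivial,
      Matrix.conjTranspose_eq_transpose_of_trivial] at h⟩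

/-- The entries of the flow are continuous in time. -/
theorem continuous_wishartFlow_entry {d : ℕ} (β : Matrix (Fin d) (Fin d) ℝ) (x : PSDCone d)
    (i j : Fin d) : Continuous fun s : ℝ => (wishartFlow β s x).1 i j := by
  let _ : NormedRing (Matrix (Fin d) (Fin d) ℝ) := Matrix.linftyOpNormedRing
  let _ : NormedAlgebra ℝ (Matrix (Fin d) (Fin d) ℝ) := Matrix.linftyOpNormedAlgebra
  let _ : NormedAlgebra ℚ (Matrix (Fin d) (Fin d) ℝ) := NormedAlgebra.restrictScalars ℚ ℝ _
  have h : ∀ b : Matrix (Fin d) (Fin d) ℝ, Continuous fun s : ℝ => NormedSpace.exp (s • b) :=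
    fun b => NormedSpace.exp_continuous.comp (continuous_id.smul continuous_const)
  have h2 : Continuous fun s : ℝ =>
      NormedSpace.exp (s • β) * x.1 * NormedSpace.exp (s • βᵀ) :=
    ((h β).mul continuous_const).mul (h βᵀ)
  exact h2.matrix_elem i j

/-- The integrated flow `σ_t^β(x) = 2 ∫_0^t ω_s^β(x) ds` (entrywise integral), for `t ≥ 0`. -/
noncomputable def wishartScale {d : ℕ} (β : Matrix (Fin d) (Fin d) ℝ) (t : ℝ≥0) (x : PSDCone d) :
    PSDCone d :=
  ⟨Matrix.of fun i j => 2 * ∫ s in (0 : ℝ)..t, (wishartFlow β s x).1 i j, by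
    refine Matrix.PosSemidef.of_dotProduct_mulVec_nonneg ?_ ?_
    · ext i j
      simp only [Matrix.conjTranspose_apply, Matrix.of_apply, star_trivial]
      congr 2
      ext s
      simpa using (wishartFlow β s x).2.1.apply i j
    · intro v
      have key : star v ⬝ᵥ (Matrix.of fun i j =>
            2 * ∫ s in (0 : ℝ)..t, (wishartFlow β s x).1 i j) *ᵥ v
          = 2 * ∫ s in (0 : ℝ)..t, star v ⬝ᵥ (wishartFlow β s x).1 *ᵥ v := by
        simp only [dotProduct, Matrix.mulVec, Matrix.of_apply]
        rw [intervalIntegral.integral_finsetSum]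
        · rw [Finset.mul_sum]
          refine Finset.sum_congr rfl fun i _ => ?_
          rw [intervalIntegral.integral_const_mul, intervalIntegral.integral_finsetSum]
          · rw [mul_left_comm, Finset.mul_sum _ _ (2 : ℝ)]
            congr 1
            refine Finset.sum_congr rfl fun j _ => ?_
            rw [intervalIntegral.integral_mul_const, mul_assoc]
          · intro j _
            exact ((continuous_wishartFlow_entry β x i j).mul
              continuous_const).intervalIntegrable _ _
        · intro i _
          refine Continuous.intervalIntegrable ?_ _ _
          exact continuous_const.mul (continuous_finsetSum _ fun j _ =>
            (continuous_wishartFlow_entry β x i j).mul continuous_const)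
      rw [key]
      refine mul_nonneg zero_le_two (intervalIntegral.integral_nonneg t.2 fun s _ => ?_)
      exact (wishartFlow β s x).2.dotProduct_mulVec_nonneg v⟩

/-! ### Positive semidefinite matrices -/

namespace Matrix

/-! The law of `X t` is found by solving the Riccati system explicitly. Conjugating `ψ` by `exp
(-tβ)` removes the linear terms and leaves `A' = -A Σ' A`, where `Σ` is the integrated flow of `α`.
Its solution is `A = u (1 + Σ u)⁻¹` (`riccati_solution`), and Jacobi's formula then gives `φ = p log
det (1 + Σ u)` (`riccati_integral`). Inserted into the affine formula, these yield the Laplace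
transform of `Γ(p, ω; σ)`. Laplace transforms determine finite measures on the cone
(`PSDCone.measure_ext_of_laplace`), which identifies the law.

The density is defined as a Radon-Nikodym derivative, so the second claim amounts to absolute
continuity of the law. By uniqueness it suffices to construct one absolutely continuous measure with
the right Laplace transform, for `p > (d - 1) / 2` and `σ` positive definite. Congruences reduce
this to `σ = 1` and diagonal `ω`, and the measure is built by induction on `d`, one row and column
at a time (`IsWishartCoords.border`).

The inductive step is modelled on the case of integer `2p`, where the matrix is a sum of `2p` terms
`y yᵀ` with independent Gaussian `y` of covariance `1/2`. Let only the first `y` have a last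
coordinate with nonzero mean, namely `√l`, and let `w` be its upper part, with mean zero. The
remaining terms contribute `S` to the upper left block `a = S + w wᵀ`. Regressing the last
coordinates on the upper ones gives an off-diagonal vector with mean `√l w` and covariance `a / 2`,
and a residual with non-central gamma law, of shape `p - d/2` and non-centrality `l (1 - w · a⁻¹
w)`. These laws make sense for every real `p > d/2`, and the Laplace transform is checked directly.
-/

open scoped MatrixOrder Matrix.Norms.L2Operator in
theorem PosSemidef.exists_mul_self {n : Type*} [Fintype n] [DecidableEq n]
    {a : Matrix n n ℝ} (ha : a.PosSemidef) : ∃ r : Matrix n n ℝ, r.PosSemidef ∧ r * r = a :=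
  ⟨CFC.sqrt a, nonneg_iff_posSemidef.1 (CFC.sqrt_nonneg a),
    CFC.sqrt_mul_sqrt_self a ha.nonneg⟩

theorem PosSemidef.trace_mul_nonneg {n : Type*} [Fintype n] [DecidableEq n]
    {a b : Matrix n n ℝ} (ha : a.PosSemidef) (hb : b.PosSemidef) : 0 ≤ (a * b).trace := by
  obtain ⟨r, hr, rfl⟩ := ha.exists_mul_self
  rw [Matrix.mul_assoc, trace_mul_comm]
  have h := hb.mul_mul_conjTranspose_same r
  rw [hr.1.eq] at h
  exact h.trace_nonneg

/-- The product `a * b` need not be symmetric, but with `a = r * r` Sylvester's identity replaces it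
by the congruence `r * b * r`. Positivity is what makes the inverse, the logarithm and the real
powers of `det (1 + σ u)` meaningful. -/
theorem PosSemidef.det_one_add_mul_pos {n : Type*} [Fintype n] [DecidableEq n]
    {a b : Matrix n n ℝ} (ha : a.PosSemidef) (hb : b.PosSemidef) : 0 < (1 + a * b).det := by
  obtain ⟨r, hr, rfl⟩ := ha.exists_mul_self
  rw [Matrix.mul_assoc, det_one_add_mul_comm]
  have h := hb.mul_mul_conjTranspose_same r
  rw [hr.1.eq] at h
  exact (PosDef.one.add_posSemidef h).det_pos

end Matrix

/-! ### Uniqueness of the Laplace transform on the cone -/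

namespace PSDCone

theorem isClosed_setOf_posSemidef (d : ℕ) :
    IsClosed {x : Matrix (Fin d) (Fin d) ℝ | x.PosSemidef} := by
  have : {x : Matrix (Fin d) (Fin d) ℝ | x.PosSemidef} =
      {x | xᴴ = x} ∩ ⋂ v : Fin d → ℝ, {x | 0 ≤ star v ⬝ᵥ (x *ᵥ v)} := by
    ext x
    simp only [Set.mem_ofPred_eq, Set.mem_inter_iff, Set.mem_iInter]
    exact ⟨fun h => ⟨h.1.eq, fun v => h.dotProduct_mulVec_nonneg v⟩,
      fun h => Matrix.PosSemidef.of_dotProduct_mulVec_nonneg h.1 h.2⟩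
  rw [this]
  refine (isClosed_eq continuous_id.matrix_conjTranspose continuous_id).inter
    (isClosed_iInter fun v => isClosed_le continuous_const ?_)
  exact continuous_const.dotProduct (continuous_id.matrix_mulVec continuous_const)

instance polishSpace (d : ℕ) : PolishSpace (PSDCone d) := by
  have : PolishSpace (Matrix (Fin d) (Fin d) ℝ) :=
    inferInstanceAs (PolishSpace (Fin d → Fin d → ℝ))
  exact (isClosed_setOf_posSemidef d).polishSpace

theorem continuous_pairing {d : ℕ} (u : PSDCone d) : Continuous fun x => u.pairing x :=
  (continuous_const.matrix_mul continuous_subtype_val).matrix_trace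

theorem pairing_nonneg {d : ℕ} (u x : PSDCone d) : 0 ≤ u.pairing x :=
  u.2.trace_mul_nonneg x.2

/-- The function `x ↦ exp (-⟨u, x⟩)` as a bounded continuous function on the cone. -/
noncomputable def expNegPairing {d : ℕ} (u : PSDCone d) :
    BoundedContinuousFunction (PSDCone d) ℝ :=
  BoundedContinuousFunction.ofNormedAddCommGroup (fun x => Real.exp (-(u.pairing x)))
    (Real.continuous_exp.comp (continuous_pairing u).neg) 1 fun x => by
      rw [Real.norm_eq_abs, Real.abs_exp, Real.exp_le_one_iff]
      exact neg_nonpos.2 (pairing_nonneg u x)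

@[simp] theorem expNegPairing_apply {d : ℕ} (u x : PSDCone d) :
    expNegPairing u x = Real.exp (-(u.pairing x)) := rfl

/-- The exponentials are closed under multiplication, so their linear span is an algebra. -/
theorem expNegPairing_mul {d : ℕ} (u v : PSDCone d) :
    expNegPairing u * expNegPairing v = expNegPairing ⟨u.1 + v.1, u.2.add v.2⟩ := by
  ext x
  simp only [BoundedContinuousFunction.coe_mul, Pi.mul_apply, expNegPairing_apply, ← Real.exp_add,
    pairing, Matrix.add_mul, Matrix.trace_add]
  ring_nf

theorem expNegPairing_zero {d : ℕ} :
    expNegPairing (⟨0, Matrix.PosSemidef.zero⟩ : PSDCone d) = 1 := by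
  ext x
  simp [pairing]

/-- Testing with `u = x` and `u = y` already shows that `x - y` has Frobenius norm zero. -/
theorem eq_of_pairing_eq {d : ℕ} {x y : PSDCone d}
    (h : ∀ u : PSDCone d, u.pairing x = u.pairing y) :
    x = y := by
  have hx := h x
  have hy := h y
  simp only [pairing] at hx hy
  have h0 : ((x.1 - y.1)ᴴ * (x.1 - y.1)).trace = 0 := by
    rw [Matrix.conjTranspose_sub, x.2.1.eq, y.2.1.eq, Matrix.sub_mul, Matrix.mul_sub,
      Matrix.mul_sub, Matrix.trace_sub, Matrix.trace_sub, Matrix.trace_sub]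
    linarith
  exact Subtype.ext (sub_eq_zero.1 (Matrix.trace_conjTranspose_mul_self_eq_zero_iff.1 h0))

/-- A finite measure on the cone is determined by its Laplace transform. -/
theorem measure_ext_of_laplace {d : ℕ} {μ ν : Measure (PSDCone d)} [IsFiniteMeasure μ]
    [IsFiniteMeasure ν]
    (h : ∀ u : PSDCone d, ∫ ξ, Real.exp (-(u.pairing ξ)) ∂μ = ∫ ξ, Real.exp (-(u.pairing ξ)) ∂ν) :
    μ = ν := by
  let S : Submonoid (BoundedContinuousFunction (PSDCone d) ℝ) :=
    { carrier := Set.range expNegPairing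
      mul_mem' := by
        rintro _ _ ⟨u, rfl⟩ ⟨v, rfl⟩
        exact ⟨_, (expNegPairing_mul u v).symm⟩
      one_mem' := ⟨_, expNegPairing_zero⟩ }
  let A : StarSubalgebra ℝ (BoundedContinuousFunction (PSDCone d) ℝ) :=
    { Algebra.adjoin ℝ (S : Set (BoundedContinuousFunction (PSDCone d) ℝ)) with
      star_mem' := fun {f} hf => by
        have : star f = f := by ext x; simp
        rwa [this] }
  refine ext_of_forall_mem_subalgebra_integral_eq_of_polish (𝕜 := ℝ) (A := A) ?_ ?_
  · intro x y hxy
    by_contra hcon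
    apply hxy
    apply eq_of_pairing_eq
    intro u
    by_contra hu
    apply hcon
    refine ⟨_, ⟨_, ⟨expNegPairing u, Algebra.subset_adjoin ⟨u, rfl⟩, rfl⟩, rfl⟩, ?_⟩
    intro he
    apply hu
    exact neg_injective (Real.exp_injective he)
  · intro g hg
    -- `S` is a submonoid, so the algebra it generates is its linear span, and linearity of the
    -- integral finishes.
    have hg' : g ∈ Submodule.span ℝ (S : Set (BoundedContinuousFunction (PSDCone d) ℝ)) := by
      have h1 : g ∈ Subalgebra.toSubmodule
          (Algebra.adjoin ℝ (S : Set (BoundedContinuousFunction (PSDCone d) ℝ))) := hg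
      rwa [Algebra.adjoin_eq_span, Submonoid.closure_eq] at h1
    clear hg
    induction hg' using Submodule.span_induction with
    | mem f hf => obtain ⟨u, rfl⟩ := hf; exact h u
    | zero => simp
    | add f g _ _ hf hg =>
      simp only [BoundedContinuousFunction.coe_add, Pi.add_apply]
      rw [integral_add (f.integrable μ) (g.integrable μ),
        integral_add (f.integrable ν) (g.integrable ν)]
      rw [hf, hg]
    | smul c f _ hf =>
      simp only [BoundedContinuousFunction.coe_smul]
      rw [integral_smul, integral_smul, hf]

end PSDCone

theorem IsNoncentralWishart.unique {d : ℕ} {p : ℝ} {ω σ : PSDCone d} {μ ν : Measure (PSDCone d)}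
    (hμ : IsNoncentralWishart p ω σ μ) (hν : IsNoncentralWishart p ω σ ν) : μ = ν := by
  have := hμ.isProbabilityMeasure
  have := hν.isProbabilityMeasure
  exact PSDCone.measure_ext_of_laplace fun u => by rw [hμ.laplace, hν.laplace]

theorem IsNoncentralWishart.eq_noncentralWishart {d : ℕ} {p : ℝ} {ω σ : PSDCone d}
    {μ : Measure (PSDCone d)} (hμ : IsNoncentralWishart p ω σ μ) :
    μ = noncentralWishart p ω σ := by
  have h : ∃ μ, IsNoncentralWishart p ω σ μ := ⟨μ, hμ⟩
  rw [noncentralWishart, dif_pos h]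
  exact hμ.unique h.choose_spec

/-! ### Solution of the Riccati equations -/

section Riccati

attribute [local instance] Matrix.linftyOpNormedRing Matrix.linftyOpNormedAlgebra

/-- Jacobi's formula for the derivative of the determinant along a curve of matrices. -/
theorem HasDerivWithinAt.matrix_det {n : Type*} [Fintype n] [DecidableEq n]
    {f : ℝ → Matrix n n ℝ} {f' : Matrix n n ℝ} {s : Set ℝ} {t : ℝ}
    (hf : HasDerivWithinAt f f' s t) :
    HasDerivWithinAt (fun r => (f r).det) (((f t).adjugate * f').trace) s t := by
  -- As a multilinear function of the rows, the determinant has as derivative a sum of determinants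
  -- with one row replaced, and Cramer's rule evaluates each of them.
  let D : ContinuousMultilinearMap ℝ (fun _ : n => n → ℝ) ℝ :=
    { (Matrix.detRowAlternating (n := n) (R := ℝ)).toMultilinearMap with
      cont := Continuous.matrix_det continuous_id }
  have h := (D.hasFDerivAt (f t)).comp_hasDerivWithinAt t hf
  refine h.congr_deriv ?_
  refine (ContinuousMultilinearMap.linearDeriv_apply D (f t) f').trans ?_
  rw [Matrix.trace_mul_comm, Matrix.trace]
  refine Finset.sum_congr rfl fun i _ => ?_
  change ((f t).updateRow i (f' i)).det = _
  rw [Matrix.diag_apply, ← Matrix.cramer_transpose_apply, Matrix.cramer_eq_adjugate_mulVec,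
    ← Matrix.adjugate_transpose, Matrix.mulVec_transpose]
  rfl

/-- `wishartScale` as a function of real time. -/
noncomputable def integratedFlow {d : ℕ} (β : Matrix (Fin d) (Fin d) ℝ) (x : PSDCone d) (t : ℝ) :
    Matrix (Fin d) (Fin d) ℝ :=
  Matrix.of fun i j => 2 * ∫ s in (0 : ℝ)..t, (wishartFlow β s x).1 i j

theorem integratedFlow_zero {d : ℕ} (β : Matrix (Fin d) (Fin d) ℝ) (x : PSDCone d) :
    integratedFlow β x 0 = 0 := by
  ext i j
  simp [integratedFlow]

theorem integratedFlow_posSemidef {d : ℕ} (β : Matrix (Fin d) (Fin d) ℝ) (x : PSDCone d) {t : ℝ}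
    (ht : 0 ≤ t) : (integratedFlow β x t).PosSemidef :=
  (wishartScale β ⟨t, ht⟩ x).2

theorem hasDerivAt_integratedFlow {d : ℕ} (β : Matrix (Fin d) (Fin d) ℝ) (x : PSDCone d) (t : ℝ) :
    HasDerivAt (integratedFlow β x) ((2 : ℝ) • (wishartFlow β t x).1) t := by
  refine hasDerivAt_pi.2 fun i => hasDerivAt_pi.2 fun j => ?_
  have hc := continuous_wishartFlow_entry β x i j
  exact (intervalIntegral.integral_hasDerivAt_right (hc.intervalIntegrable _ _)
    (hc.stronglyMeasurableAtFilter _ _) hc.continuousAt).const_mul 2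

theorem exp_smul_mul_exp_smul_neg {d : ℕ} (b : Matrix (Fin d) (Fin d) ℝ) (t : ℝ) :
    NormedSpace.exp (t • b) * NormedSpace.exp (t • -b) = 1 := by
  rw [smul_neg, ← Matrix.exp_add_of_commute _ _ (Commute.refl (t • b)).neg_right, add_neg_cancel,
    NormedSpace.exp_zero]

theorem exp_smul_neg_mul_exp_smul {d : ℕ} (b : Matrix (Fin d) (Fin d) ℝ) (t : ℝ) :
    NormedSpace.exp (t • -b) * NormedSpace.exp (t • b) = 1 := by
  simpa using exp_smul_mul_exp_smul_neg (-b) t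

/-- A solution of a linear matrix equation `B' = M B` on `[0, ∞)` which starts at zero vanishes. -/
theorem eq_zero_of_hasDerivWithinAt_mul {d : ℕ} {B M : ℝ → Matrix (Fin d) (Fin d) ℝ}
    (hM : ContinuousOn M (Set.Ici 0)) (h0 : B 0 = 0)
    (hB : ∀ t ≥ (0 : ℝ), HasDerivWithinAt B (M t * B t) (Set.Ici 0) t) {t : ℝ} (ht : 0 ≤ t) :
    B t = 0 := by
  obtain ⟨C, hC⟩ := isCompact_Icc.exists_bound_of_continuousOn
    (hM.mono (Set.Icc_subset_Ici_self : Set.Icc 0 t ⊆ Set.Ici 0))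
  -- A bound for `M` on the compact interval `[0, t]` is a uniform Lipschitz constant for the
  -- equation.
  have hlip : ∀ s ∈ Set.Ico 0 t, LipschitzOnWith C.toNNReal
      (fun X : Matrix (Fin d) (Fin d) ℝ => M s * X) Set.univ := by
    intro s hs
    refine LipschitzOnWith.of_dist_le_mul fun X _ Y _ => ?_
    rw [dist_eq_norm, dist_eq_norm, ← mul_sub]
    refine (norm_mul_le _ _).trans (mul_le_mul_of_nonneg_right ?_ (norm_nonneg _))
    exact (hC s (Set.Ico_subset_Icc_self hs)).trans (Real.le_coe_toNNReal C)
  have hcont : ContinuousOn B (Set.Icc 0 t) := fun s hs =>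
    ((hB s hs.1).continuousWithinAt).mono Set.Icc_subset_Ici_self
  have := ODE_solution_unique_of_mem_Icc_right (f := B) (g := fun _ => 0) (a := 0) (b := t)
    (s := fun _ => Set.univ) (v := fun s X => M s * X) hlip hcont
    (fun s hs => (hB s hs.1).mono (Set.Ici_subset_Ici.2 hs.1)) (fun _ _ => trivial)
    continuousOn_const
    (fun s hs => by simpa using hasDerivWithinAt_const s (Set.Ici s) (0 : Matrix (Fin d) (Fin d) ℝ))
    (fun _ _ => trivial) h0
  exact this ⟨ht, le_rfl⟩

/-- No inverse is differentiated: the defect `A (1 + Σ u) - u` of the expected solution satisfies a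
homogeneous linear equation with zero initial value, hence vanishes. -/
theorem riccati_solution {d : ℕ} (α : PSDCone d) (β : Matrix (Fin d) (Fin d) ℝ)
    {u : Matrix (Fin d) (Fin d) ℝ} (hu : u.PosSemidef) {ψ : ℝ → Matrix (Fin d) (Fin d) ℝ}
    (h0 : ψ 0 = u)
    (hψ : ∀ t ≥ (0 : ℝ), HasDerivWithinAt ψ
      (-(2 : ℝ) • (ψ t * α.1 * ψ t) + ψ t * β + βᵀ * ψ t) (Set.Ici 0) t)
    {t : ℝ} (ht : 0 ≤ t) :
    ψ t = NormedSpace.exp (t • βᵀ) * (u * (1 + integratedFlow β α t * u)⁻¹) *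
      NormedSpace.exp (t • β) := by
  let A : ℝ → Matrix (Fin d) (Fin d) ℝ := fun s =>
    NormedSpace.exp (s • -βᵀ) * ψ s * NormedSpace.exp (s • -β)
  let S' : ℝ → Matrix (Fin d) (Fin d) ℝ := fun s => (2 : ℝ) • (wishartFlow β s α).1
  have hA : ∀ s ≥ (0 : ℝ), HasDerivWithinAt A (-(A s * S' s * A s)) (Set.Ici 0) s := by
    intro s hs
    have h1 := (hasDerivAt_exp_smul_const (-βᵀ) s).hasDerivWithinAt (s := Set.Ici 0)
    have h2 := (hasDerivAt_exp_smul_const' (-β) s).hasDerivWithinAt (s := Set.Ici 0)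
    refine ((h1.mul (hψ s hs)).mul h2).congr_deriv ?_
    have e1 := exp_smul_neg_mul_exp_smul β s
    have e2 := exp_smul_mul_exp_smul_neg βᵀ s
    have key : A s * S' s * A s = (2 : ℝ) •
        (NormedSpace.exp (s • -βᵀ) * (ψ s * α.1 * ψ s) * NormedSpace.exp (s • -β)) := by
      simp only [A, S', wishartFlow, Matrix.mul_smul, Matrix.smul_mul]
      congr 1
      calc _ = NormedSpace.exp (s • -βᵀ) * ψ s *
            (NormedSpace.exp (s • -β) * NormedSpace.exp (s • β)) * α.1 *
            (NormedSpace.exp (s • βᵀ) * NormedSpace.exp (s • -βᵀ)) * ψ s *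
            NormedSpace.exp (s • -β) := by simp only [Matrix.mul_assoc]
        _ = _ := by rw [e1, e2]; simp only [Matrix.mul_assoc, Matrix.one_mul]
    rw [key]
    simp only [Pi.mul_apply, neg_smul, Matrix.mul_add, Matrix.add_mul, Matrix.mul_neg,
      Matrix.neg_mul, Matrix.mul_smul, Matrix.smul_mul, Matrix.mul_assoc]
    abel
  have hAcont : ContinuousOn A (Set.Ici 0) := fun s hs => (hA s hs).continuousWithinAt
  have hS'cont : Continuous S' := by
    refine continuous_matrix fun i j => ?_
    exact (continuous_wishartFlow_entry β α i j).const_smul (2 : ℝ)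
  -- The product rule gives `-A Σ' A (1 + Σ u) + A Σ' u`, which factors through the defect itself.
  have hB : ∀ s ≥ (0 : ℝ), HasDerivWithinAt
      (fun r => A r * (1 + integratedFlow β α r * u) - u)
      (-(A s * S' s) * (A s * (1 + integratedFlow β α s * u) - u)) (Set.Ici 0) s := by
    intro s hs
    have h3 := ((hasDerivAt_integratedFlow β α s).hasDerivWithinAt (s := Set.Ici 0)).mul_const u
    refine (((hA s hs).mul (h3.const_add 1)).sub_const u).congr_deriv ?_
    simp only [S']
    noncomm_ring
  have hzero := eq_zero_of_hasDerivWithinAt_mul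
    (B := fun r => A r * (1 + integratedFlow β α r * u) - u) (M := fun s => -(A s * S' s))
    ((hAcont.mul hS'cont.continuousOn).neg)
    (by simp [A, h0, integratedFlow_zero]) hB ht
  have hdet := (integratedFlow_posSemidef β α ht).det_one_add_mul_pos hu
  have hAt : A t = u * (1 + integratedFlow β α t * u)⁻¹ := by
    nth_rewrite 1 [← sub_eq_zero.1 hzero]
    rw [Matrix.mul_assoc, Matrix.mul_nonsing_inv _ (isUnit_iff_ne_zero.2 hdet.ne'), Matrix.mul_one]
  rw [← hAt]
  calc ψ t = (NormedSpace.exp (t • βᵀ) * NormedSpace.exp (t • -βᵀ)) * ψ t *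
        (NormedSpace.exp (t • -β) * NormedSpace.exp (t • β)) := by
        rw [exp_smul_mul_exp_smul_neg, exp_smul_neg_mul_exp_smul, Matrix.one_mul, Matrix.mul_one]
    _ = _ := by simp only [A, Matrix.mul_assoc]

/-- Both sides vanish at zero. By Jacobi's formula and cyclicity of the trace, the derivative of
`log det (1 + Σ u)` is `2 tr (α ψ)`. -/
theorem riccati_integral {d : ℕ} {p : ℝ} (α : PSDCone d) (β : Matrix (Fin d) (Fin d) ℝ)
    {u : Matrix (Fin d) (Fin d) ℝ} (hu : u.PosSemidef) {ψ : ℝ → Matrix (Fin d) (Fin d) ℝ}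
    (h0 : ψ 0 = u)
    (hψ : ∀ t ≥ (0 : ℝ), HasDerivWithinAt ψ
      (-(2 : ℝ) • (ψ t * α.1 * ψ t) + ψ t * β + βᵀ * ψ t) (Set.Ici 0) t)
    {φ : ℝ → ℝ} (hφ0 : φ 0 = 0)
    (hφ : ∀ t ≥ (0 : ℝ), HasDerivWithinAt φ (2 * p * (α.1 * ψ t).trace) (Set.Ici 0) t)
    {t : ℝ} (ht : 0 ≤ t) :
    φ t = p * Real.log (1 + integratedFlow β α t * u).det := by
  have hg : ∀ s ≥ (0 : ℝ), HasDerivWithinAt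
      (fun r => p * Real.log (1 + integratedFlow β α r * u).det)
      (2 * p * (α.1 * ψ s).trace) (Set.Ici 0) s := by
    intro s hs
    have hdet := (integratedFlow_posSemidef β α hs).det_one_add_mul_pos hu
    have h3 := ((hasDerivAt_integratedFlow β α s).hasDerivWithinAt (s := Set.Ici 0)).mul_const u
    have h4 := ((h3.const_add 1).matrix_det.log hdet.ne').const_mul p
    refine h4.congr_deriv ?_
    rw [riccati_solution α β hu h0 hψ hs]
    have hinv : (1 + integratedFlow β α s * u)⁻¹ =
        (1 + integratedFlow β α s * u).det⁻¹ • (1 + integratedFlow β α s * u).adjugate := by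
      rw [Matrix.inv_def, Ring.inverse_eq_inv']
    have h5 : (α.1 * (NormedSpace.exp (s • βᵀ) * (u * (1 + integratedFlow β α s * u)⁻¹) *
        NormedSpace.exp (s • β))).trace =
        ((1 + integratedFlow β α s * u)⁻¹ * ((wishartFlow β s α).1 * u)).trace := by
      simp only [wishartFlow]
      rw [Matrix.trace_mul_comm (1 + integratedFlow β α s * u)⁻¹]
      rw [← Matrix.mul_assoc α.1, Matrix.trace_mul_comm _ (NormedSpace.exp (s • β))]
      simp only [Matrix.mul_assoc]
    rw [h5, hinv]
    simp only [Matrix.smul_mul, Matrix.mul_smul, Matrix.trace_smul, smul_eq_mul]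
    field_simp
  refine eq_of_has_deriv_right_eq (a := 0) (b := t)
    (fun s hs => (hφ s hs.1).mono (Set.Ici_subset_Ici.2 hs.1))
    (fun s hs => (hg s hs.1).mono (Set.Ici_subset_Ici.2 hs.1))
    (fun s hs => ((hφ s hs.1).continuousWithinAt).mono Set.Icc_subset_Ici_self)
    (fun s hs => ((hg s hs.1).continuousWithinAt).mono Set.Icc_subset_Ici_self) ?_ t ⟨ht, le_rfl⟩
  simp [hφ0, integratedFlow_zero]

end Riccati

/-- The marginal laws of a Wishart process are non-central Wishart distributions. -/
theorem IsWishartProcess.isNoncentralWishart {d : ℕ} {Ω : Type*} [mΩ : MeasurableSpace Ω]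
    {ℱ : Filtration ℝ≥0 mΩ} {X : ℝ≥0 → Ω → PSDCone d} {P : PSDCone d → Measure Ω}
    {p : ℝ} {α : PSDCone d} {β : Matrix (Fin d) (Fin d) ℝ}
    (hX : IsWishartProcess ℱ X P p α β) (t : ℝ≥0) (x : PSDCone d) :
    IsNoncentralWishart p (wishartFlow β t x) (wishartScale β t α) ((P x).map (X t)) := by
  obtain ⟨-, φ, ψ, haff, hφ0, hψ0, hφ, hψ⟩ := hX
  have hmeas : Measurable (X t) := (haff.markov.adapted t).mono (ℱ.le t) le_rfl
  have := haff.markov.isProbabilityMeasure x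
  refine ⟨Measure.isProbabilityMeasure_map hmeas.aemeasurable, fun u => ?_⟩
  have hψ' : ∀ s ≥ (0 : ℝ), HasDerivWithinAt (fun r => (ψ r u).1)
      (-(2 : ℝ) • ((ψ s u).1 * α.1 * (ψ s u).1) + (ψ s u).1 * β + βᵀ * (ψ s u).1)
      (Set.Ici 0) s := fun s hs =>
    hasDerivWithinAt_pi.2 fun i => hasDerivWithinAt_pi.2 fun j => hψ u s hs i j
  have ht : (0 : ℝ) ≤ t := t.2
  have hu0 : (ψ 0 u).1 = u.1 := by rw [hψ0]
  have hdet := (integratedFlow_posSemidef β α ht).det_one_add_mul_pos u.2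
  have hsol := riccati_solution α β u.2 hu0 hψ' ht
  have hint := riccati_integral (p := p) α β u.2 hu0 hψ' (hφ0 u) (hφ u) ht
  rw [integral_map hmeas.aemeasurable (f := fun ξ => Real.exp (-(u.pairing ξ)))
    (PSDCone.expNegPairing u).continuous.aestronglyMeasurable, haff.affine, hint, PSDCone.pairing,
    hsol, sub_eq_add_neg, Real.exp_add]
  change _ = (1 + integratedFlow β α t * u.1).det ^ (-p) *
    Real.exp (-(u.1 * (1 + integratedFlow β α t * u.1)⁻¹ * (wishartFlow β t x).1).trace)
  congr 1
  · rw [Real.rpow_def_of_pos hdet]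
    ring_nf
  · congr 2
    simp only [wishartFlow]
    rw [← Matrix.mul_assoc _ _ (NormedSpace.exp _), Matrix.trace_mul_comm _ (NormedSpace.exp _)]
    simp only [Matrix.mul_assoc]

/-! ### Gaussian and gamma integrals -/

theorem lintegral_exp_neg_dotProduct_self (n : Type*) [Fintype n] :
    ∫⁻ y : n → ℝ, ENNReal.ofReal (Real.exp (-(y ⬝ᵥ y))) =
      ENNReal.ofReal (√Real.pi ^ Fintype.card n) := by
  have hprod : (fun y : n → ℝ => Real.exp (-(y ⬝ᵥ y))) =
      fun y => ∏ i, Real.exp (-1 * y i ^ 2) := by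
    funext y
    rw [← Real.exp_sum]
    congr 1
    rw [dotProduct, ← Finset.sum_neg_distrib]
    exact Finset.sum_congr rfl fun i _ => by ring
  have hint : Integrable (fun x : ℝ => Real.exp (-1 * x ^ 2)) := integrable_exp_neg_mul_sq one_pos
  rw [← ofReal_integral_eq_lintegral_ofReal]
  · rw [hprod, integral_fintype_prod_volume_eq_pow (ι := n) (fun x : ℝ => Real.exp (-1 * x ^ 2)),
      integral_gaussian, div_one]
  · rw [hprod]
    exact Integrable.fintype_prod fun _ => hint
  · exact Filter.Eventually.of_forall fun y => (Real.exp_pos _).le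

/-- Complete the square with the symmetric root `r` of `a`: the substitution `y = r b - r⁻¹ c`
reduces to the standard Gaussian integral with Jacobian `√(det a)`. -/
theorem lintegral_exp_neg_quadratic {n : Type*} [Fintype n] [DecidableEq n] {a : Matrix n n ℝ}
    (ha : a.PosDef) (c : n → ℝ) :
    ∫⁻ b : n → ℝ, ENNReal.ofReal (Real.exp (-(b ⬝ᵥ a *ᵥ b) + 2 * (c ⬝ᵥ b))) =
      ENNReal.ofReal (√Real.pi ^ Fintype.card n * (√a.det)⁻¹ * Real.exp (c ⬝ᵥ a⁻¹ *ᵥ c)) := by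
  obtain ⟨r, hr, hra⟩ := ha.posSemidef.exists_mul_self
  have hdet : a.det = r.det * r.det := by rw [← hra, Matrix.det_mul]
  have hr0 : r.det ≠ 0 := by
    intro h
    have := ha.det_pos
    rw [hdet, h] at this
    simp at this
  have hrT : rᵀ = r := by simpa using hr.1.eq
  have hinv : a⁻¹ = r⁻¹ * r⁻¹ := by rw [← hra, Matrix.mul_inv_rev]
  have hsq : ∀ b : n → ℝ, -(b ⬝ᵥ a *ᵥ b) + 2 * (c ⬝ᵥ b) =
      c ⬝ᵥ a⁻¹ *ᵥ c + -((r *ᵥ b - r⁻¹ *ᵥ c) ⬝ᵥ (r *ᵥ b - r⁻¹ *ᵥ c)) := by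
    intro b
    have hrr : r⁻¹ᵀ = r⁻¹ := by rw [Matrix.transpose_nonsing_inv, hrT]
    have h1 : ∀ x y : n → ℝ, (r *ᵥ x) ⬝ᵥ y = x ⬝ᵥ (r *ᵥ y) := fun x y => by
      rw [← Matrix.vecMul_transpose, hrT, Matrix.dotProduct_mulVec]
    have h2 : ∀ x y : n → ℝ, (r⁻¹ *ᵥ x) ⬝ᵥ y = x ⬝ᵥ (r⁻¹ *ᵥ y) := fun x y => by
      rw [← Matrix.vecMul_transpose, hrr, Matrix.dotProduct_mulVec]
    have hu := isUnit_iff_ne_zero.2 hr0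
    rw [sub_dotProduct, dotProduct_sub, dotProduct_sub, h1, h1, h2, h2, hinv, ← hra]
    simp only [Matrix.mulVec_mulVec, Matrix.mul_nonsing_inv r hu, Matrix.nonsing_inv_mul r hu,
      Matrix.one_mulVec]
    rw [dotProduct_comm b c]
    ring
  simp_rw [hsq, Real.exp_add, ENNReal.ofReal_mul (Real.exp_pos _).le]
  let G : (n → ℝ) → ℝ≥0∞ := fun y => ENNReal.ofReal (Real.exp (-(y ⬝ᵥ y)))
  have hG : Measurable G := by
    refine ENNReal.measurable_ofReal.comp (Continuous.measurable ?_)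
    exact Real.continuous_exp.comp (continuous_id.dotProduct continuous_id).neg
  have hG' : Measurable fun y => G (y - r⁻¹ *ᵥ c) := hG.comp (measurable_id.sub_const _)
  have hmap := Real.map_matrix_volume_pi_eq_smul_volume_pi hr0
  have hmeas : Measurable (Matrix.toLin' r) :=
    (LinearMap.continuous_of_finiteDimensional (Matrix.toLin' r)).measurable
  rw [lintegral_const_mul]
  · have h3 : ∫⁻ b : n → ℝ, G (r *ᵥ b - r⁻¹ *ᵥ c) =
        ENNReal.ofReal |(r.det)⁻¹| * ENNReal.ofReal (√Real.pi ^ Fintype.card n) := by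
      have := lintegral_map (μ := (volume : Measure (n → ℝ))) hG' hmeas
      rw [hmap, lintegral_smul_measure, lintegral_sub_right_eq_self] at this
      rw [← lintegral_exp_neg_dotProduct_self n]
      exact this.symm
    rw [h3, hdet, Real.sqrt_mul_self_eq_abs, abs_inv, ← ENNReal.ofReal_mul (by positivity),
      ← ENNReal.ofReal_mul (by positivity)]
    congr 1
    ring
  · exact hG'.comp (Continuous.matrix_mulVec continuous_const continuous_id).measurable

/-- The density of the non-central gamma distribution, a Poisson mixture of gamma densities. -/
noncomputable def noncentralGammaPDF (q l x : ℝ) : ℝ≥0∞ :=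
  ∑' k : ℕ, ENNReal.ofReal (Real.exp (-l) * (l ^ k / k.factorial)) * gammaPDF (q + k) 1 x

theorem measurable_noncentralGammaPDF (q : ℝ) :
    Measurable fun z : ℝ × ℝ => noncentralGammaPDF q z.1 z.2 := by
  refine Measurable.tsum fun k => Measurable.fun_mul ?_ ?_
  · fun_prop
  · exact ENNReal.measurable_ofReal.comp ((measurable_gammaPDFReal _ _).comp measurable_snd)

theorem noncentralGammaPDF_of_neg (q l : ℝ) {x : ℝ} (hx : x < 0) :
    noncentralGammaPDF q l x = 0 := by
  simp [noncentralGammaPDF, gammaPDF_of_neg hx]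

/-- Exponential tilting only changes the rate of a gamma density, from `1` to `1 + h`, up to a
constant. -/
theorem gammaPDF_mul_exp {a h : ℝ} (hh : 0 ≤ h) (x : ℝ) :
    gammaPDF a 1 x * ENNReal.ofReal (Real.exp (-(h * x))) =
      ENNReal.ofReal ((1 + h) ^ (-a)) * gammaPDF a (1 + h) x := by
  rcases lt_or_ge x 0 with hx | hx
  · simp [gammaPDF_of_neg hx]
  · rw [gammaPDF_of_nonneg hx, gammaPDF_of_nonneg hx, ← ENNReal.ofReal_mul' (Real.exp_pos _).le,
      ← ENNReal.ofReal_mul (by positivity)]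
    congr 1
    have h1 : (1 + h) ^ (-a) * (1 + h) ^ a = 1 := by
      rw [← Real.rpow_add (by positivity), neg_add_cancel, Real.rpow_zero]
    have h2 : Real.exp (-((1 + h) * x)) = Real.exp (-(1 * x)) * Real.exp (-(h * x)) := by
      rw [← Real.exp_add]; ring_nf
    rw [h2, Real.one_rpow]
    linear_combination (-(1 / Real.Gamma a * x ^ (a - 1) *
      (Real.exp (-(1 * x)) * Real.exp (-(h * x))))) * h1

theorem lintegral_noncentralGammaPDF_mul_exp {q l h : ℝ} (hq : 0 < q) (hl : 0 ≤ l) (hh : 0 ≤ h) :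
    ∫⁻ x, noncentralGammaPDF q l x * ENNReal.ofReal (Real.exp (-(h * x))) =
      ENNReal.ofReal ((1 + h) ^ (-q) * Real.exp (-(h / (1 + h) * l))) := by
  have hpos : 0 < 1 + h := by positivity
  have hmeas : ∀ k : ℕ, Measurable fun x => ENNReal.ofReal (Real.exp (-l) * (l ^ k / k.factorial)) *
      (ENNReal.ofReal ((1 + h) ^ (-(q + k))) * gammaPDF (q + k) (1 + h) x) := fun k =>
    (((measurable_gammaPDFReal _ _).ennreal_ofReal).const_mul _).const_mul _
  have hterm : ∀ k : ℕ, 0 ≤ Real.exp (-l) * (l ^ k / k.factorial) * (1 + h) ^ (-(q + k)) :=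
    fun k => by positivity
  simp_rw [noncentralGammaPDF, ← ENNReal.tsum_mul_right, mul_assoc, gammaPDF_mul_exp hh]
  rw [lintegral_tsum fun k => (hmeas k).aemeasurable]
  have h1 : ∀ k : ℕ, ∫⁻ x, ENNReal.ofReal (Real.exp (-l) * (l ^ k / k.factorial)) *
      (ENNReal.ofReal ((1 + h) ^ (-(q + k))) * gammaPDF (q + k) (1 + h) x) =
      ENNReal.ofReal (Real.exp (-l) * (l ^ k / k.factorial) * (1 + h) ^ (-(q + k))) := by
    intro k
    have hg : Measurable (gammaPDF (q + k) (1 + h)) := (measurable_gammaPDFReal _ _).ennreal_ofReal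
    rw [lintegral_const_mul _ (hg.const_mul _), lintegral_const_mul _ hg,
      lintegral_gammaPDF_eq_one (by positivity) hpos, mul_one, ← ENNReal.ofReal_mul (by positivity)]
  simp_rw [h1]
  -- This is the exponential series at `l / (1 + h)`; the exponents combine as `-l + l / (1 + h) =
  -- -(h / (1 + h)) l`.
  have h2 : HasSum (fun k : ℕ => Real.exp (-l) * (l ^ k / k.factorial) * (1 + h) ^ (-(q + k)))
      ((1 + h) ^ (-q) * Real.exp (-(h / (1 + h) * l))) := by
    have h3 := (NormedSpace.expSeries_div_hasSum_exp (l / (1 + h))).mul_left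
      (Real.exp (-l) * (1 + h) ^ (-q))
    rw [← Real.exp_eq_exp_ℝ] at h3
    convert! h3 using 1
    · funext k
      rw [neg_add, Real.rpow_add hpos, Real.rpow_neg hpos.le (k : ℝ), Real.rpow_natCast, div_pow]
      field_simp
    · rw [mul_comm (Real.exp (-l)), mul_assoc, ← Real.exp_add]
      congr 2
      field_simp
      ring
  rw [← ENNReal.ofReal_tsum_of_nonneg hterm h2.summable, h2.tsum_eq]

/-! ### Bordered matrices -/

/-- The symmetric matrix with upper left block `a`, last row and column `(b, c)`. -/
def borderedMatrix {d : ℕ} (a : Matrix (Fin d) (Fin d) ℝ) (b : Fin d → ℝ) (c : ℝ) :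
    Matrix (Fin (d + 1)) (Fin (d + 1)) ℝ :=
  Matrix.of fun i j => Fin.lastCases (motive := fun _ => ℝ)
    (Fin.lastCases (motive := fun _ => ℝ) c b j)
    (fun i' => Fin.lastCases (motive := fun _ => ℝ) (b i') (a i') j) i

namespace borderedMatrix

variable {d : ℕ} (a : Matrix (Fin d) (Fin d) ℝ) (b : Fin d → ℝ) (c : ℝ)

@[simp] theorem castSucc_castSucc (i j : Fin d) :
    borderedMatrix a b c i.castSucc j.castSucc = a i j := by simp [borderedMatrix]

@[simp] theorem castSucc_last (i : Fin d) :
    borderedMatrix a b c i.castSucc (Fin.last d) = b i := by simp [borderedMatrix]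

@[simp] theorem last_castSucc (j : Fin d) :
    borderedMatrix a b c (Fin.last d) j.castSucc = b j := by simp [borderedMatrix]

@[simp] theorem last_last :
    borderedMatrix a b c (Fin.last d) (Fin.last d) = c := by simp [borderedMatrix]

variable (a' : Matrix (Fin d) (Fin d) ℝ) (b' : Fin d → ℝ) (c' : ℝ)

theorem mul_castSucc_castSucc (i j : Fin d) :
    (borderedMatrix a b c * borderedMatrix a' b' c') i.castSucc j.castSucc =
      (a * a') i j + b i * b' j := by
  simp [Matrix.mul_apply, Fin.sum_univ_castSucc]

theorem mul_castSucc_last (i : Fin d) :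
    (borderedMatrix a b c * borderedMatrix a' b' c') i.castSucc (Fin.last d) =
      (a *ᵥ b') i + b i * c' := by
  simp [Matrix.mul_apply, Fin.sum_univ_castSucc, Matrix.mulVec, dotProduct]

theorem mul_last_castSucc (j : Fin d) :
    (borderedMatrix a b c * borderedMatrix a' b' c') (Fin.last d) j.castSucc =
      (b ᵥ* a') j + c * b' j := by
  simp [Matrix.mul_apply, Fin.sum_univ_castSucc, Matrix.vecMul, dotProduct]

theorem mul_last_last :
    (borderedMatrix a b c * borderedMatrix a' b' c') (Fin.last d) (Fin.last d) =
      b ⬝ᵥ b' + c * c' := by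
  simp [Matrix.mul_apply, Fin.sum_univ_castSucc, dotProduct]

end borderedMatrix

theorem matrix_succ_ext {d : ℕ} {x y : Matrix (Fin (d + 1)) (Fin (d + 1)) ℝ}
    (h1 : ∀ i j : Fin d, x i.castSucc j.castSucc = y i.castSucc j.castSucc)
    (h2 : ∀ i : Fin d, x i.castSucc (Fin.last d) = y i.castSucc (Fin.last d))
    (h3 : ∀ j : Fin d, x (Fin.last d) j.castSucc = y (Fin.last d) j.castSucc)
    (h4 : x (Fin.last d) (Fin.last d) = y (Fin.last d) (Fin.last d)) : x = y := by
  ext i j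
  induction i using Fin.lastCases with
  | last => induction j using Fin.lastCases with
    | last => exact h4
    | cast j => exact h3 j
  | cast i => induction j using Fin.lastCases with
    | last => exact h2 i
    | cast j => exact h1 i j

theorem eq_borderedMatrix {d : ℕ} {x : Matrix (Fin (d + 1)) (Fin (d + 1)) ℝ} (hx : xᵀ = x) :
    x = borderedMatrix (x.submatrix Fin.castSucc Fin.castSucc)
      (fun i => x i.castSucc (Fin.last d)) (x (Fin.last d) (Fin.last d)) := by
  refine matrix_succ_ext (by simp) (by simp) (fun j => ?_) (by simp)
  rw [borderedMatrix.last_castSucc]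
  exact congrFun (congrFun hx.symm (Fin.last d)) j.castSucc

theorem transpose_borderedMatrix {d : ℕ} (a : Matrix (Fin d) (Fin d) ℝ) (b : Fin d → ℝ) (c : ℝ) :
    (borderedMatrix a b c)ᵀ = borderedMatrix aᵀ b c :=
  matrix_succ_ext (by simp) (by simp) (by simp) (by simp)

theorem one_add_borderedMatrix {d : ℕ} (a : Matrix (Fin d) (Fin d) ℝ) (b : Fin d → ℝ) (c : ℝ) :
    1 + borderedMatrix a b c = borderedMatrix (1 + a) b (1 + c) := by
  refine matrix_succ_ext (fun i j => ?_) (fun i => ?_) (fun j => ?_) (by simp)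
  · simp [Matrix.one_apply]
  · simp [(Fin.castSucc_lt_last i).ne]
  · simp [(Fin.castSucc_lt_last j).ne']

theorem trace_borderedMatrix_mul {d : ℕ} (a a' : Matrix (Fin d) (Fin d) ℝ) (b b' : Fin d → ℝ)
    (c c' : ℝ) : (borderedMatrix a b c * borderedMatrix a' b' c').trace =
      (a * a').trace + 2 * (b ⬝ᵥ b') + c * c' := by
  simp only [Matrix.trace, Matrix.diag_apply, Matrix.mul_apply, Fin.sum_univ_castSucc,
    borderedMatrix.castSucc_castSucc, borderedMatrix.castSucc_last, borderedMatrix.last_castSucc,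
    borderedMatrix.last_last, Finset.sum_add_distrib, dotProduct]
  ring

theorem snoc_dotProduct_borderedMatrix_mulVec {d : ℕ} (a : Matrix (Fin d) (Fin d) ℝ)
    (b v : Fin d → ℝ) (c s : ℝ) :
    (Fin.snoc v s : Fin (d + 1) → ℝ) ⬝ᵥ borderedMatrix a b c *ᵥ (Fin.snoc v s : Fin (d + 1) → ℝ) =
      v ⬝ᵥ a *ᵥ v + 2 * s * (b ⬝ᵥ v) + c * s ^ 2 := by
  simp only [dotProduct, Matrix.mulVec, Fin.sum_univ_castSucc, Fin.snoc_castSucc, Fin.snoc_last,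
    borderedMatrix.castSucc_castSucc, borderedMatrix.castSucc_last, borderedMatrix.last_castSucc,
    borderedMatrix.last_last, mul_add, Finset.sum_add_distrib, Finset.mul_sum]
  have : ∑ x, v x * (b x * s) = ∑ x, s * (b x * v x) := Finset.sum_congr rfl fun x _ => by ring
  have h2 : ∑ x, 2 * s * (b x * v x) = 2 * ∑ x, s * (b x * v x) := by
    rw [Finset.mul_sum]; exact Finset.sum_congr rfl fun x _ => by ring
  rw [this, h2]
  ring

theorem det_borderedMatrix {d : ℕ} (a : Matrix (Fin d) (Fin d) ℝ) (b : Fin d → ℝ) {c : ℝ}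
    (hc : c ≠ 0) :
    (borderedMatrix a b c).det = c * (a - c⁻¹ • Matrix.vecMulVec b b).det := by
  have h : borderedMatrix a b c = (Matrix.fromBlocks a (Matrix.replicateCol (Fin 1) b)
      (Matrix.replicateRow (Fin 1) b) (Matrix.of fun _ _ => c)).submatrix
        finSumFinEquiv.symm finSumFinEquiv.symm := by
    have hl : finSumFinEquiv.symm (Fin.last d) = (Sum.inr 0 : Fin d ⊕ Fin 1) :=
      finSumFinEquiv_symm_last
    have hi : ∀ i : Fin d, finSumFinEquiv.symm i.castSucc = (Sum.inl i : Fin d ⊕ Fin 1) :=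
      fun i => finSumFinEquiv_symm_apply_castAdd i
    refine matrix_succ_ext ?_ ?_ ?_ ?_ <;> simp [hl, hi]
  have hD : (Matrix.of fun _ _ => c : Matrix (Fin 1) (Fin 1) ℝ) = c • 1 := by
    ext i j
    simp [Subsingleton.elim i j]
  let _ : Invertible (c • 1 : Matrix (Fin 1) (Fin 1) ℝ) :=
    ⟨c⁻¹ • 1, by simp [smul_smul, hc], by simp [smul_smul, hc]⟩
  rw [h, Matrix.det_submatrix_equiv_self, hD, Matrix.det_fromBlocks₂₂]
  congr 1
  · simp
  · congr 2
    change Matrix.replicateCol (Fin 1) b * (c⁻¹ • 1) * Matrix.replicateRow (Fin 1) b = _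
    ext i j
    simp [Matrix.mul_apply, Matrix.vecMulVec_apply]
    ring

theorem vecMulVec_self_posSemidef {n : Type*} [Finite n] (v : n → ℝ) :
    (Matrix.vecMulVec v v).PosSemidef := by
  simpa using Matrix.posSemidef_vecMulVec_self_star v

theorem dotProduct_vecMulVec_mulVec {n : Type*} [Fintype n] (b v : n → ℝ) :
    v ⬝ᵥ Matrix.vecMulVec b b *ᵥ v = (b ⬝ᵥ v) ^ 2 := by
  rw [Matrix.vecMulVec_mulVec, dotProduct_smul, dotProduct_comm v b]
  simp [pow_two]

/-- Here `s` is the Schur complement of `a`: completing the square turns the form at `(v, t)` into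
the `a`-form at `v + t a⁻¹ b` plus `s t²`. -/
theorem borderedMatrix_posDef {d : ℕ} {a : Matrix (Fin d) (Fin d) ℝ} (ha : a.PosDef)
    (b : Fin d → ℝ) {s : ℝ} (hs : 0 < s) : (borderedMatrix a b (b ⬝ᵥ a⁻¹ *ᵥ b + s)).PosDef := by
  have haT : aᵀ = a := by simpa using ha.1.eq
  have hdet : IsUnit a.det := isUnit_iff_ne_zero.2 ha.det_pos.ne'
  refine Matrix.PosDef.of_dotProduct_mulVec_pos ?_ fun z hz => ?_
  · rw [Matrix.IsHermitian, Matrix.conjTranspose_eq_transpose_of_trivial, transpose_borderedMatrix,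
      haT]
  · obtain ⟨v, t, rfl⟩ : ∃ (v : Fin d → ℝ) (t : ℝ), z = (Fin.snoc v t : Fin (d + 1) → ℝ) :=
      ⟨fun i => z i.castSucc, z (Fin.last d), by
        funext i; induction i using Fin.lastCases <;> simp⟩
    rw [star_trivial, snoc_dotProduct_borderedMatrix_mulVec]
    have hsq : v ⬝ᵥ a *ᵥ v + 2 * t * (b ⬝ᵥ v) + (b ⬝ᵥ a⁻¹ *ᵥ b + s) * t ^ 2 =
        (v + t • a⁻¹ *ᵥ b) ⬝ᵥ a *ᵥ (v + t • a⁻¹ *ᵥ b) + s * t ^ 2 := by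
      have h1 : (a⁻¹ *ᵥ b) ⬝ᵥ a *ᵥ v = b ⬝ᵥ v := by
        rw [Matrix.dotProduct_mulVec, ← Matrix.mulVec_transpose, haT, Matrix.mulVec_mulVec,
          Matrix.mul_nonsing_inv a hdet, Matrix.one_mulVec]
      rw [Matrix.mulVec_add, Matrix.mulVec_smul, Matrix.mulVec_mulVec,
        Matrix.mul_nonsing_inv a hdet, Matrix.one_mulVec, add_dotProduct, dotProduct_add,
        dotProduct_add, smul_dotProduct, smul_dotProduct, dotProduct_smul, dotProduct_smul, h1,
        dotProduct_comm v b, dotProduct_comm (a⁻¹ *ᵥ b) b]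
      simp only [smul_eq_mul]
      ring
    rw [hsq]
    by_cases ht : t = 0
    · subst ht
      have hv : v ≠ 0 := by
        rintro rfl
        apply hz
        funext i
        induction i using Fin.lastCases <;> simp
      simpa using ha.dotProduct_mulVec_pos hv
    · have h1 := ha.posSemidef.dotProduct_mulVec_nonneg (v + t • a⁻¹ *ᵥ b)
      rw [star_trivial] at h1
      positivity

/-- With `y = (s + w wᵀ)⁻¹ w` and `θ = w · y`, one has `θ = y · s y + θ² ≥ θ²`. This keeps the
non-centrality `l (1 - θ)` in `borderDensity` nonnegative. -/
theorem dotProduct_inv_mulVec_le_one {n : Type*} [Fintype n] [DecidableEq n] {s : Matrix n n ℝ}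
    (hs : s.PosDef) (w : n → ℝ) :
    w ⬝ᵥ (s + Matrix.vecMulVec w w)⁻¹ *ᵥ w ≤ 1 := by
  have ha : (s + Matrix.vecMulVec w w).PosDef := hs.add_posSemidef (vecMulVec_self_posSemidef w)
  have hdet : IsUnit (s + Matrix.vecMulVec w w).det := isUnit_iff_ne_zero.2 ha.det_pos.ne'
  set y := (s + Matrix.vecMulVec w w)⁻¹ *ᵥ w with hy
  have hw : (s + Matrix.vecMulVec w w) *ᵥ y = w := by
    rw [hy, Matrix.mulVec_mulVec, Matrix.mul_nonsing_inv _ hdet, Matrix.one_mulVec]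
  have h1 : y ⬝ᵥ (s + Matrix.vecMulVec w w) *ᵥ y = w ⬝ᵥ y := by rw [hw, dotProduct_comm]
  rw [Matrix.add_mulVec, dotProduct_add, dotProduct_vecMulVec_mulVec] at h1
  have h2 := hs.posSemidef.dotProduct_mulVec_nonneg y
  rw [star_trivial] at h2
  nlinarith

/-! ### Schur complement of the corner `1 + h` in `1 + u`. -/

section SchurComplement

variable {d : ℕ} {U : Matrix (Fin d) (Fin d) ℝ} {k : Fin d → ℝ} {h : ℝ}

theorem borderedMatrix_posSemidef_upperLeft (hu : (borderedMatrix U k h).PosSemidef) :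
    U.PosSemidef := by
  have := hu.submatrix (Fin.castSucc : Fin d → Fin (d + 1))
  convert! this using 1
  ext i j
  simp

theorem borderedMatrix_posSemidef_corner (hu : (borderedMatrix U k h).PosSemidef) : 0 ≤ h := by
  simpa using hu.diag_nonneg (i := Fin.last d)

/-- This matrix is the argument at which the induction hypothesis is evaluated. At the test vector
`(v, -(k · v) / (1 + h))` the form of `u` equals the form of this matrix at `v` minus a square.
Dividing by `1 + h` also covers `h = 0`. -/
theorem borderedMatrix_posSemidef_schur (hu : (borderedMatrix U k h).PosSemidef) :
    (U - (1 + h)⁻¹ • Matrix.vecMulVec k k).PosSemidef := by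
  have hh := borderedMatrix_posSemidef_corner hu
  have hU := borderedMatrix_posSemidef_upperLeft hu
  refine Matrix.PosSemidef.of_dotProduct_mulVec_nonneg ?_ fun v => ?_
  · exact hU.1.sub ((vecMulVec_self_posSemidef k).smul (by positivity)).1
  · have h1 := hu.dotProduct_mulVec_nonneg (Fin.snoc v (-((k ⬝ᵥ v) / (1 + h))) : Fin (d + 1) → ℝ)
    rw [star_trivial, snoc_dotProduct_borderedMatrix_mulVec] at h1
    rw [star_trivial, Matrix.sub_mulVec, dotProduct_sub, Matrix.smul_mulVec, dotProduct_smul,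
      dotProduct_vecMulVec_mulVec, smul_eq_mul]
    have h2 : 0 ≤ ((k ⬝ᵥ v) / (1 + h)) ^ 2 := sq_nonneg _
    have h3 : v ⬝ᵥ U *ᵥ v - (1 + h)⁻¹ * (k ⬝ᵥ v) ^ 2 =
        (v ⬝ᵥ U *ᵥ v + 2 * -((k ⬝ᵥ v) / (1 + h)) * (k ⬝ᵥ v) + h * (-((k ⬝ᵥ v) / (1 + h))) ^ 2) +
        ((k ⬝ᵥ v) / (1 + h)) ^ 2 := by
      field_simp
      ring
    rw [h3]
    exact add_nonneg h1 h2

theorem det_one_add_borderedMatrix (hh : 0 ≤ h) :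
    (1 + borderedMatrix U k h).det =
      (1 + h) * (1 + (U - (1 + h)⁻¹ • Matrix.vecMulVec k k)).det := by
  rw [one_add_borderedMatrix, det_borderedMatrix _ _ (by positivity), add_sub_assoc]

theorem inv_one_add_borderedMatrix (hu : (borderedMatrix U k h).PosSemidef) :
    (1 + borderedMatrix U k h)⁻¹ =
      borderedMatrix (1 + (U - (1 + h)⁻¹ • Matrix.vecMulVec k k))⁻¹
        (-(1 + h)⁻¹ • (1 + (U - (1 + h)⁻¹ • Matrix.vecMulVec k k))⁻¹ *ᵥ k)
        ((1 + h)⁻¹ + (1 + h)⁻¹ ^ 2 *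
          (k ⬝ᵥ (1 + (U - (1 + h)⁻¹ • Matrix.vecMulVec k k))⁻¹ *ᵥ k)) := by
  have hh := borderedMatrix_posSemidef_corner hu
  have hpos : 0 < 1 + h := by positivity
  have hV := Matrix.PosDef.one.add_posSemidef (borderedMatrix_posSemidef_schur hu)
  set Y := 1 + (U - (1 + h)⁻¹ • Matrix.vecMulVec k k) with hY
  have hdet : IsUnit Y.det := isUnit_iff_ne_zero.2 hV.det_pos.ne'
  have hYT : Y⁻¹ᵀ = Y⁻¹ := by
    rw [Matrix.transpose_nonsing_inv]
    congr 1
    simpa using hV.1.eq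
  have hUY : 1 + U = Y + (1 + h)⁻¹ • Matrix.vecMulVec k k := by rw [hY]; abel
  have hYY := Matrix.mul_nonsing_inv Y hdet
  have hk : Y *ᵥ (Y⁻¹ *ᵥ k) = k := by rw [Matrix.mulVec_mulVec, hYY, Matrix.one_mulVec]
  have hkY : k ᵥ* Y⁻¹ = Y⁻¹ *ᵥ k := by rw [← Matrix.mulVec_transpose, hYT]
  refine Matrix.inv_eq_right_inv ?_
  rw [one_add_borderedMatrix, hUY]
  refine matrix_succ_ext (fun i j => ?_) (fun i => ?_) (fun j => ?_) ?_
  · rw [borderedMatrix.mul_castSucc_castSucc, Matrix.add_mul, hYY, Matrix.smul_mul,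
      Matrix.vecMulVec_mul, hkY]
    simp [Matrix.one_apply, Matrix.vecMulVec_apply]
    ring
  · rw [borderedMatrix.mul_castSucc_last, Matrix.mulVec_smul, Matrix.add_mulVec, hk,
      Matrix.smul_mulVec, Matrix.vecMulVec_mulVec]
    simp [(Fin.castSucc_lt_last i).ne]
    field_simp
    ring
  · rw [borderedMatrix.mul_last_castSucc, hkY]
    simp [(Fin.castSucc_lt_last j).ne']
    field_simp
    ring
  · rw [borderedMatrix.mul_last_last, dotProduct_smul, smul_eq_mul, Matrix.one_apply_eq]
    field_simp
    ring

/-- Since `x (1 + x)⁻¹ = 1 - (1 + x)⁻¹` and the border of `ω` is zero, only the diagonal blocks of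
the inverse enter. -/
theorem trace_mul_inv_one_add_borderedMatrix (hu : (borderedMatrix U k h).PosSemidef)
    (ω : Matrix (Fin d) (Fin d) ℝ) (l : ℝ) :
    (borderedMatrix U k h * (1 + borderedMatrix U k h)⁻¹ * borderedMatrix ω 0 l).trace =
      ((U - (1 + h)⁻¹ • Matrix.vecMulVec k k) *
        (1 + (U - (1 + h)⁻¹ • Matrix.vecMulVec k k))⁻¹ * ω).trace +
      l * (h / (1 + h) - (1 + h)⁻¹ ^ 2 *
        (k ⬝ᵥ (1 + (U - (1 + h)⁻¹ • Matrix.vecMulVec k k))⁻¹ *ᵥ k)) := by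
  have hh := borderedMatrix_posSemidef_corner hu
  have hpos : 0 < 1 + h := by positivity
  have key : ∀ {n : ℕ} {x : Matrix (Fin n) (Fin n) ℝ} (y : Matrix (Fin n) (Fin n) ℝ),
      x.PosSemidef → (x * (1 + x)⁻¹ * y).trace = y.trace - ((1 + x)⁻¹ * y).trace := by
    intro n x y hx
    have hdet : IsUnit (1 + x).det :=
      isUnit_iff_ne_zero.2 (Matrix.PosDef.one.add_posSemidef hx).det_pos.ne'
    have : x * (1 + x)⁻¹ = 1 - (1 + x)⁻¹ := by
      rw [eq_sub_iff_add_eq]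
      nth_rewrite 2 [← Matrix.one_mul (1 + x)⁻¹]
      rw [← Matrix.add_mul, add_comm x 1, Matrix.mul_nonsing_inv _ hdet]
    rw [this, Matrix.sub_mul, Matrix.one_mul, Matrix.trace_sub]
  rw [key _ hu, key _ (borderedMatrix_posSemidef_schur hu), inv_one_add_borderedMatrix hu,
    trace_borderedMatrix_mul]
  have ht : (borderedMatrix ω 0 l).trace = ω.trace + l := by
    simp [Matrix.trace, Fin.sum_univ_castSucc]
  rw [ht, dotProduct_zero]
  field_simp
  ring

end SchurComplement

/-! ### Coordinates on symmetric matrices -/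

/-- The coordinate space of the symmetric `d × d` matrices. -/
abbrev SymCoords (d : ℕ) : Type := {q : Fin d × Fin d // q.1 ≤ q.2} → ℝ

/-- `symmetricOfCoords` as a linear map. -/
noncomputable def symMatrix (d : ℕ) : SymCoords d →ₗ[ℝ] Matrix (Fin d) (Fin d) ℝ where
  toFun := symmetricOfCoords d
  map_add' v w := by
    ext i j
    by_cases h : i = j <;> simp [symmetricOfCoords, h, add_div]
  map_smul' r v := by
    ext i j
    by_cases h : i = j <;> simp [symmetricOfCoords, h, mul_div_assoc]

/-- The coordinates of a symmetric matrix. -/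
noncomputable def symCoords (d : ℕ) : Matrix (Fin d) (Fin d) ℝ →ₗ[ℝ] SymCoords d where
  toFun x q := if q.1.1 = q.1.2 then x q.1.1 q.1.2 else √2 * x q.1.1 q.1.2
  map_add' x y := by
    ext q
    by_cases h : q.1.1 = q.1.2 <;> simp [h, mul_add]
  map_smul' r x := by
    ext q
    by_cases h : q.1.1 = q.1.2 <;> simp [h]
    ring

theorem symMatrix_transpose {d : ℕ} (v : SymCoords d) : (symMatrix d v)ᵀ = symMatrix d v := by
  ext i j
  change symmetricOfCoords d v j i = symmetricOfCoords d v i j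
  by_cases h : i = j
  · rw [h]
  · simp [symmetricOfCoords, h, Ne.symm h, min_comm, max_comm]

theorem symMatrix_symCoords {d : ℕ} {x : Matrix (Fin d) (Fin d) ℝ} (hx : xᵀ = x) :
    symMatrix d (symCoords d x) = x := by
  ext i j
  change symmetricOfCoords d (symCoords d x) i j = x i j
  have hs : ∀ i j, x i j = x j i := fun i j => (congrFun (congrFun hx i) j).symm
  by_cases h : i = j
  · subst h; simp [symmetricOfCoords, symCoords]
  · rcases le_total i j with hij | hij
    · simp [symmetricOfCoords, symCoords, h, hij]
    · simp [symmetricOfCoords, symCoords, h, hij, hs i j]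

theorem symCoords_symMatrix {d : ℕ} (v : SymCoords d) : symCoords d (symMatrix d v) = v := by
  ext ⟨⟨i, j⟩, hij⟩
  change (if i = j then symmetricOfCoords d v i j else √2 * symmetricOfCoords d v i j) = _
  by_cases h : i = j
  · subst h; simp [symmetricOfCoords]
  · simp only [h, if_false, symmetricOfCoords, Matrix.of_apply]
    field_simp
    congr 1
    simp only [Subtype.mk.injEq, Prod.mk.injEq]
    exact ⟨min_eq_left hij, max_eq_right hij⟩

theorem continuous_symMatrix (d : ℕ) : Continuous (symMatrix d) :=
  LinearMap.continuous_of_finiteDimensional _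

theorem continuous_symCoords (d : ℕ) : Continuous (symCoords d) :=
  LinearMap.continuous_of_finiteDimensional _

theorem measurableEmbedding_symMatrix (d : ℕ) : MeasurableEmbedding (symMatrix d) := by
  have : IsClosed (Set.range (symMatrix d)) := Submodule.closed_of_finiteDimensional
    (LinearMap.range (symMatrix d))
  exact MeasurableEmbedding.of_measurable_inverse (g := symCoords d)
    (continuous_symMatrix d).measurable this.measurableSet (continuous_symCoords d).measurable
    symCoords_symMatrix

/-- Haar measures have the same null sets. As only absolute continuity is at stake, Jacobians of
congruence and bordering need not be computed. -/
theorem LinearEquiv.quasiMeasurePreserving_addHaar {E F : Type*} [NormedAddCommGroup E]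
    [NormedSpace ℝ E] [FiniteDimensional ℝ E] [MeasurableSpace E] [BorelSpace E]
    [NormedAddCommGroup F] [NormedSpace ℝ F] [FiniteDimensional ℝ F] [MeasurableSpace F]
    [BorelSpace F] (L : E ≃ₗ[ℝ] F) (μ : Measure E) [μ.IsAddHaarMeasure] (ν : Measure F)
    [ν.IsAddHaarMeasure] : Measure.QuasiMeasurePreserving L μ ν := by
  have h := L.toContinuousLinearEquiv.isAddHaarMeasure_map μ
  refine ⟨L.toContinuousLinearEquiv.continuous.measurable, ?_⟩
  exact Measure.absolutelyContinuous_isAddHaarMeasure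
    (Measure.map L.toContinuousLinearEquiv μ) ν

theorem transpose_congruence {n : Type*} [Fintype n] {x : Matrix n n ℝ} (hx : xᵀ = x)
    (g : Matrix n n ℝ) : (g * x * gᵀ)ᵀ = g * x * gᵀ := by
  rw [Matrix.transpose_mul, Matrix.transpose_mul, hx, Matrix.transpose_transpose, Matrix.mul_assoc]

/-- The congruence `x ↦ g x gᵀ` in coordinates, as a linear map. -/
noncomputable def congrCoordsLinear {d : ℕ} (g : Matrix (Fin d) (Fin d) ℝ) :
    SymCoords d →ₗ[ℝ] SymCoords d :=
  symCoords d ∘ₗ (LinearMap.mulRight ℝ gᵀ ∘ₗ LinearMap.mulLeft ℝ g) ∘ₗ symMatrix d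

theorem symMatrix_congrCoordsLinear {d : ℕ} (g : Matrix (Fin d) (Fin d) ℝ) (v : SymCoords d) :
    symMatrix d (congrCoordsLinear g v) = g * symMatrix d v * gᵀ :=
  symMatrix_symCoords (transpose_congruence (symMatrix_transpose v) g)

theorem congrCoordsLinear_comp {d : ℕ} {g h : Matrix (Fin d) (Fin d) ℝ} (hgh : g * h = 1) :
    congrCoordsLinear g ∘ₗ congrCoordsLinear h = LinearMap.id := by
  refine LinearMap.ext fun v => ?_
  rw [LinearMap.comp_apply, LinearMap.id_apply, ← symCoords_symMatrix (congrCoordsLinear g _),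
    symMatrix_congrCoordsLinear, symMatrix_congrCoordsLinear]
  have : g * (h * symMatrix d v * hᵀ) * gᵀ = (g * h) * symMatrix d v * (g * h)ᵀ := by
    simp only [Matrix.transpose_mul, Matrix.mul_assoc]
  rw [this, hgh, Matrix.transpose_one, Matrix.one_mul, Matrix.mul_one, symCoords_symMatrix]

/-- The congruence `x ↦ g x gᵀ` in coordinates, for invertible `g`. -/
noncomputable def congrCoords {d : ℕ} (g : Matrix (Fin d) (Fin d) ℝ) (hg : g.det ≠ 0) :
    SymCoords d ≃ₗ[ℝ] SymCoords d :=
  LinearEquiv.ofLinearMap (congrCoordsLinear g) (congrCoordsLinear g⁻¹)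
    (congrCoordsLinear_comp (Matrix.mul_nonsing_inv g (isUnit_iff_ne_zero.2 hg)))
    (congrCoordsLinear_comp (Matrix.nonsing_inv_mul g (isUnit_iff_ne_zero.2 hg)))

theorem symMatrix_congrCoords {d : ℕ} (g : Matrix (Fin d) (Fin d) ℝ) (hg : g.det ≠ 0)
    (v : SymCoords d) : symMatrix d (congrCoords g hg v) = g * symMatrix d v * gᵀ :=
  symMatrix_congrCoordsLinear g v

/-- Bordering a symmetric matrix by a row and a column, in coordinates. -/
noncomputable def borderedCoords (d : ℕ) :
    ((SymCoords d × (Fin d → ℝ)) × ℝ) ≃ₗ[ℝ] SymCoords (d + 1) where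
  toFun z := symCoords (d + 1) (borderedMatrix (symMatrix d z.1.1) z.1.2 z.2)
  map_add' y z := by
    rw [← map_add]
    congr 1
    refine matrix_succ_ext ?_ ?_ ?_ ?_ <;> simp
  map_smul' r z := by
    rw [RingHom.id_apply, ← map_smul]
    congr 1
    refine matrix_succ_ext ?_ ?_ ?_ ?_ <;> simp
  invFun v := ((symCoords d ((symMatrix (d + 1) v).submatrix Fin.castSucc Fin.castSucc),
    fun i => symMatrix (d + 1) v i.castSucc (Fin.last d)),
    symMatrix (d + 1) v (Fin.last d) (Fin.last d))
  left_inv z := by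
    have h : symMatrix (d + 1) (symCoords (d + 1)
        (borderedMatrix (symMatrix d z.1.1) z.1.2 z.2)) =
        borderedMatrix (symMatrix d z.1.1) z.1.2 z.2 :=
      symMatrix_symCoords (by rw [transpose_borderedMatrix, symMatrix_transpose])
    have h2 : (borderedMatrix (symMatrix d z.1.1) z.1.2 z.2).submatrix Fin.castSucc Fin.castSucc =
        symMatrix d z.1.1 := by ext; simp
    simp only [h, h2, symCoords_symMatrix, borderedMatrix.castSucc_last, borderedMatrix.last_last]
  right_inv v := by
    dsimp only
    rw [symMatrix_symCoords, ← eq_borderedMatrix (symMatrix_transpose v), symCoords_symMatrix]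
    rw [Matrix.transpose_submatrix, symMatrix_transpose]

theorem symMatrix_borderedCoords {d : ℕ} (v : SymCoords d) (b : Fin d → ℝ) (c : ℝ) :
    symMatrix (d + 1) (borderedCoords d ((v, b), c)) = borderedMatrix (symMatrix d v) b c :=
  symMatrix_symCoords (by rw [transpose_borderedMatrix, symMatrix_transpose])

/-! ### The Laplace transform of a bordered Wishart matrix -/

/-- The joint density of the border in the inductive construction of the non-central Wishart
distribution: given the matrix `S`, the vector `w` is Gaussian, given `S` and `w` the off-diagonal
part `b` is Gaussian with mean `√l w` and covariance `(S + w wᵀ) / 2`, and the Schur complement `s`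
has a non-central gamma distribution. -/
noncomputable def borderDensity {d : ℕ} (q l : ℝ) (S : Matrix (Fin d) (Fin d) ℝ)
    (w b : Fin d → ℝ) (s : ℝ) : ℝ≥0∞ :=
  ENNReal.ofReal ((√Real.pi ^ d)⁻¹ * Real.exp (-(w ⬝ᵥ w)) *
    ((√Real.pi ^ d)⁻¹ * (√(S + Matrix.vecMulVec w w).det)⁻¹ *
      Real.exp (-((b - √l • w) ⬝ᵥ (S + Matrix.vecMulVec w w)⁻¹ *ᵥ (b - √l • w))))) *
  noncentralGammaPDF q (l * (1 - w ⬝ᵥ (S + Matrix.vecMulVec w w)⁻¹ *ᵥ w)) s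

section

variable {d : ℕ} {U : Matrix (Fin d) (Fin d) ℝ} {k : Fin d → ℝ} {h : ℝ}

theorem trace_mul_vecMulVec {n : Type*} [Fintype n] (x : Matrix n n ℝ) (w : n → ℝ) :
    (x * Matrix.vecMulVec w w).trace = w ⬝ᵥ x *ᵥ w := by
  rw [Matrix.mul_vecMulVec, Matrix.trace_vecMulVec, dotProduct_comm]

theorem trace_vecMulVec_mul {n : Type*} [Fintype n] (x : Matrix n n ℝ) (w : n → ℝ) :
    (Matrix.vecMulVec w w * x).trace = w ⬝ᵥ x *ᵥ w := by
  rw [Matrix.trace_mul_comm, trace_mul_vecMulVec]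

theorem inv_sqrt_det_smul_inv (a : Matrix (Fin d) (Fin d) ℝ) {c : ℝ} (hc : 0 < c) :
    (√(c • a⁻¹).det)⁻¹ = √a.det * c ^ (-((d : ℝ) / 2)) := by
  rw [Matrix.det_smul, Fintype.card_fin, Matrix.det_nonsing_inv, Ring.inverse_eq_inv',
    Real.sqrt_mul (by positivity), Real.sqrt_inv, mul_inv, inv_inv, mul_comm]
  congr 1
  rw [Real.sqrt_eq_rpow, ← Real.rpow_natCast, ← Real.rpow_mul hc.le, ← Real.rpow_neg hc.le]
  congr 1
  ring

/-- First `s` is integrated out by the non-central gamma transform, then `b` by a Gaussian integral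
with form `(1 + h) a⁻¹`, whose determinant cancels the normalisation and leaves `(1 + h) ^ (-d/2)`.
The result is a function of `w` times a function of `S`, so the remaining integrals separate. -/
theorem lintegral_borderDensity_mul_exp {q l : ℝ} (hq : 0 < q) (hl : 0 ≤ l)
    (hu : (borderedMatrix U k h).PosSemidef) {S : Matrix (Fin d) (Fin d) ℝ} (hS : S.PosDef)
    (w : Fin d → ℝ) :
    ∫⁻ b, ∫⁻ s, borderDensity q l S w b s *
      ENNReal.ofReal (Real.exp (-(borderedMatrix U k h * borderedMatrix (S + Matrix.vecMulVec w w) b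
        (b ⬝ᵥ (S + Matrix.vecMulVec w w)⁻¹ *ᵥ b + s)).trace)) =
    ENNReal.ofReal ((√Real.pi ^ d)⁻¹ * (1 + h) ^ (-(q + d / 2)) * Real.exp (-(h / (1 + h) * l))) *
      (ENNReal.ofReal (Real.exp (-(w ⬝ᵥ (1 + (U - (1 + h)⁻¹ • Matrix.vecMulVec k k)) *ᵥ w) +
          2 * ((-(√l * (1 + h)⁻¹) • k) ⬝ᵥ w))) *
        ENNReal.ofReal (Real.exp (-((U - (1 + h)⁻¹ • Matrix.vecMulVec k k) * S).trace))) := by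
  have hh := borderedMatrix_posSemidef_corner hu
  have hpos : 0 < 1 + h := by positivity
  have ha : (S + Matrix.vecMulVec w w).PosDef := hS.add_posSemidef (vecMulVec_self_posSemidef w)
  have hle := dotProduct_inv_mulVec_le_one hS w
  have htr : ∀ x : Matrix (Fin d) (Fin d) ℝ, (x * (S + Matrix.vecMulVec w w)).trace =
      (x * S).trace + w ⬝ᵥ x *ᵥ w := fun x => by
    rw [Matrix.mul_add, Matrix.trace_add, trace_mul_vecMulVec]
  have hka : k ⬝ᵥ (S + Matrix.vecMulVec w w) *ᵥ k =
      (Matrix.vecMulVec k k * S).trace + (k ⬝ᵥ w) ^ 2 := by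
    rw [Matrix.add_mulVec, dotProduct_add, trace_vecMulVec_mul, dotProduct_vecMulVec_mulVec,
      dotProduct_comm w k]
  have hVS : ((U - (1 + h)⁻¹ • Matrix.vecMulVec k k) * S).trace =
      (U * S).trace - (1 + h)⁻¹ * (Matrix.vecMulVec k k * S).trace := by
    rw [Matrix.sub_mul, Matrix.trace_sub, Matrix.smul_mul, Matrix.trace_smul, smul_eq_mul]
  have hVw : w ⬝ᵥ (1 + (U - (1 + h)⁻¹ • Matrix.vecMulVec k k)) *ᵥ w =
      w ⬝ᵥ w + w ⬝ᵥ U *ᵥ w - (1 + h)⁻¹ * (k ⬝ᵥ w) ^ 2 := by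
    rw [Matrix.add_mulVec, Matrix.one_mulVec, dotProduct_add, Matrix.sub_mulVec, dotProduct_sub,
      Matrix.smul_mulVec, dotProduct_smul, dotProduct_vecMulVec_mulVec, smul_eq_mul]
    ring
  have hUa := htr U
  have hdet : IsUnit (S + Matrix.vecMulVec w w).det := isUnit_iff_ne_zero.2 ha.det_pos.ne'
  set a := S + Matrix.vecMulVec w w with ha_def
  have haT : aᵀ = a := by simpa using ha.1.eq
  have hainvT : a⁻¹ᵀ = a⁻¹ := by rw [Matrix.transpose_nonsing_inv, haT]
  have hsymm : ∀ x y : Fin d → ℝ, x ⬝ᵥ a⁻¹ *ᵥ y = y ⬝ᵥ a⁻¹ *ᵥ x := fun x y => by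
    rw [Matrix.dotProduct_mulVec, ← Matrix.mulVec_transpose, hainvT, dotProduct_comm]
  have haw : a *ᵥ (a⁻¹ *ᵥ w) = w := by
    rw [Matrix.mulVec_mulVec, Matrix.mul_nonsing_inv a hdet, Matrix.one_mulVec]
  have hawdot : ∀ y : Fin d → ℝ, (a⁻¹ *ᵥ w) ⬝ᵥ a *ᵥ y = w ⬝ᵥ y := fun y => by
    rw [Matrix.dotProduct_mulVec, ← Matrix.mulVec_transpose, haT, haw]
  have hlsq : √l * √l = l := Real.mul_self_sqrt hl
  have hinner : ∀ b : Fin d → ℝ, ∫⁻ s, borderDensity q l S w b s *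
      ENNReal.ofReal (Real.exp (-(borderedMatrix U k h * borderedMatrix a b
        (b ⬝ᵥ a⁻¹ *ᵥ b + s)).trace)) =
      ENNReal.ofReal ((√Real.pi ^ d)⁻¹ * (√Real.pi ^ d)⁻¹ * (√a.det)⁻¹ * (1 + h) ^ (-q) *
        Real.exp (-(w ⬝ᵥ w) - l * (w ⬝ᵥ a⁻¹ *ᵥ w) - (U * a).trace -
          h / (1 + h) * (l * (1 - w ⬝ᵥ a⁻¹ *ᵥ w)))) *
      ENNReal.ofReal (Real.exp (-(b ⬝ᵥ ((1 + h) • a⁻¹) *ᵥ b) +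
        2 * ((√l • a⁻¹ *ᵥ w - k) ⬝ᵥ b))) := by
    intro b
    have hsplit : ∀ s, borderDensity q l S w b s *
        ENNReal.ofReal (Real.exp (-(borderedMatrix U k h * borderedMatrix a b
          (b ⬝ᵥ a⁻¹ *ᵥ b + s)).trace)) =
        ENNReal.ofReal ((√Real.pi ^ d)⁻¹ * Real.exp (-(w ⬝ᵥ w)) *
          ((√Real.pi ^ d)⁻¹ * (√a.det)⁻¹ *
            Real.exp (-((b - √l • w) ⬝ᵥ a⁻¹ *ᵥ (b - √l • w)))) *
          Real.exp (-((U * a).trace + 2 * (k ⬝ᵥ b) + h * (b ⬝ᵥ a⁻¹ *ᵥ b)))) *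
        (noncentralGammaPDF q (l * (1 - w ⬝ᵥ a⁻¹ *ᵥ w)) s *
          ENNReal.ofReal (Real.exp (-(h * s)))) := by
      intro s
      have : Real.exp (-(borderedMatrix U k h * borderedMatrix a b
          (b ⬝ᵥ a⁻¹ *ᵥ b + s)).trace) =
          Real.exp (-((U * a).trace + 2 * (k ⬝ᵥ b) + h * (b ⬝ᵥ a⁻¹ *ᵥ b))) *
          Real.exp (-(h * s)) := by
        rw [trace_borderedMatrix_mul, ← Real.exp_add]
        congr 1
        ring
      rw [this, ENNReal.ofReal_mul (Real.exp_pos _).le, borderDensity, ← ha_def,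
        ENNReal.ofReal_mul (q := Real.exp (-((U * a).trace + 2 * (k ⬝ᵥ b) +
          h * (b ⬝ᵥ a⁻¹ *ᵥ b)))) (by positivity)]
      ring
    simp_rw [hsplit]
    have hm : Measurable fun s => noncentralGammaPDF q (l * (1 - w ⬝ᵥ a⁻¹ *ᵥ w)) s *
        ENNReal.ofReal (Real.exp (-(h * s))) := by
      refine Measurable.fun_mul ?_ (by fun_prop)
      exact (measurable_noncentralGammaPDF q).comp (measurable_const.prodMk measurable_id)
    rw [lintegral_const_mul _ hm, lintegral_noncentralGammaPDF_mul_exp hq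
      (mul_nonneg hl (sub_nonneg.2 hle)) hh, ← ENNReal.ofReal_mul (by positivity),
      ← ENNReal.ofReal_mul (by positivity)]
    congr 1
    have hexp : (b - √l • w) ⬝ᵥ a⁻¹ *ᵥ (b - √l • w) =
        b ⬝ᵥ a⁻¹ *ᵥ b - 2 * √l * ((a⁻¹ *ᵥ w) ⬝ᵥ b) + l * (w ⬝ᵥ a⁻¹ *ᵥ w) := by
      rw [Matrix.mulVec_sub, sub_dotProduct, dotProduct_sub, dotProduct_sub, Matrix.mulVec_smul,
        smul_dotProduct, smul_dotProduct, dotProduct_smul, dotProduct_smul, hsymm w b,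
        dotProduct_comm (a⁻¹ *ᵥ w) b]
      simp only [smul_eq_mul]
      linear_combination (w ⬝ᵥ a⁻¹ *ᵥ w) * hlsq
    have hlin : (√l • a⁻¹ *ᵥ w - k) ⬝ᵥ b = √l * ((a⁻¹ *ᵥ w) ⬝ᵥ b) - k ⬝ᵥ b := by
      rw [sub_dotProduct, smul_dotProduct, smul_eq_mul]
    have hquad : b ⬝ᵥ ((1 + h) • a⁻¹) *ᵥ b = (1 + h) * (b ⬝ᵥ a⁻¹ *ᵥ b) := by
      rw [Matrix.smul_mulVec, dotProduct_smul, smul_eq_mul]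
    rw [hexp, hlin, hquad]
    have hE : Real.exp (-(w ⬝ᵥ w)) *
        Real.exp (-(b ⬝ᵥ a⁻¹ *ᵥ b - 2 * √l * ((a⁻¹ *ᵥ w) ⬝ᵥ b) + l * (w ⬝ᵥ a⁻¹ *ᵥ w))) *
        Real.exp (-((U * a).trace + 2 * (k ⬝ᵥ b) + h * (b ⬝ᵥ a⁻¹ *ᵥ b))) *
        Real.exp (-(h / (1 + h) * (l * (1 - w ⬝ᵥ a⁻¹ *ᵥ w)))) =
        Real.exp (-(w ⬝ᵥ w) - l * (w ⬝ᵥ a⁻¹ *ᵥ w) - (U * a).trace -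
          h / (1 + h) * (l * (1 - w ⬝ᵥ a⁻¹ *ᵥ w))) *
        Real.exp (-((1 + h) * (b ⬝ᵥ a⁻¹ *ᵥ b)) +
          2 * (√l * ((a⁻¹ *ᵥ w) ⬝ᵥ b) - k ⬝ᵥ b)) := by
      simp only [← Real.exp_add]
      congr 1
      ring
    linear_combination ((√Real.pi ^ d)⁻¹ * (√Real.pi ^ d)⁻¹ * (√a.det)⁻¹ * (1 + h) ^ (-q)) * hE
  simp_rw [hinner]
  have hpd : ((1 + h) • a⁻¹).PosDef := ha.inv.smul hpos
  have hmeas : Measurable fun b : Fin d → ℝ => ENNReal.ofReal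
      (Real.exp (-(b ⬝ᵥ ((1 + h) • a⁻¹) *ᵥ b) + 2 * ((√l • a⁻¹ *ᵥ w - k) ⬝ᵥ b))) := by
    refine ENNReal.measurable_ofReal.comp (Continuous.measurable (Real.continuous_exp.comp ?_))
    exact ((continuous_id.dotProduct (continuous_const.matrix_mulVec continuous_id)).neg).add
      (continuous_const.mul (continuous_const.dotProduct continuous_id))
  rw [lintegral_const_mul _ hmeas, lintegral_exp_neg_quadratic hpd, inv_sqrt_det_smul_inv a hpos,
    ← ENNReal.ofReal_mul (by positivity), ← ENNReal.ofReal_mul (by positivity),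
    ← ENNReal.ofReal_mul (by positivity), Fintype.card_fin]
  congr 1
  have hinvinv : ((1 + h) • a⁻¹)⁻¹ = (1 + h)⁻¹ • a := by
    refine Matrix.inv_eq_right_inv ?_
    rw [Matrix.smul_mul, Matrix.mul_smul, smul_smul, Matrix.nonsing_inv_mul a hdet,
      mul_inv_cancel₀ hpos.ne', one_smul]
  have hquad : (√l • a⁻¹ *ᵥ w - k) ⬝ᵥ ((1 + h) • a⁻¹)⁻¹ *ᵥ (√l • a⁻¹ *ᵥ w - k) =
      (1 + h)⁻¹ * (l * (w ⬝ᵥ a⁻¹ *ᵥ w) - 2 * √l * (k ⬝ᵥ w) + k ⬝ᵥ a *ᵥ k) := by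
    rw [hinvinv, Matrix.smul_mulVec, dotProduct_smul, Matrix.mulVec_sub, Matrix.mulVec_smul, haw,
      sub_dotProduct, dotProduct_sub, dotProduct_sub, smul_dotProduct, smul_dotProduct, hawdot,
      dotProduct_smul, dotProduct_smul, dotProduct_comm (a⁻¹ *ᵥ w) w, dotProduct_comm w k]
    simp only [smul_eq_mul]
    linear_combination ((1 + h)⁻¹ * (w ⬝ᵥ a⁻¹ *ᵥ w)) * hlsq
  have hpow : (1 + h) ^ (-(q + (d : ℝ) / 2)) = (1 + h) ^ (-q) * (1 + h) ^ (-((d : ℝ) / 2)) := by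
    rw [neg_add, Real.rpow_add hpos]
  -- All terms in `θ = w · a⁻¹ w` cancel: `-l θ - (h / (1 + h)) l (1 - θ) + l θ / (1 + h) = -(h / (1
  -- + h)) l`. This is why the non-centrality has the factor `1 - θ`.
  have hE : Real.exp (-(w ⬝ᵥ w) - l * (w ⬝ᵥ a⁻¹ *ᵥ w) - (U * a).trace -
          h / (1 + h) * (l * (1 - w ⬝ᵥ a⁻¹ *ᵥ w))) *
        Real.exp ((√l • a⁻¹ *ᵥ w - k) ⬝ᵥ ((1 + h) • a⁻¹)⁻¹ *ᵥ (√l • a⁻¹ *ᵥ w - k)) =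
      Real.exp (-(h / (1 + h) * l)) *
      (Real.exp (-(w ⬝ᵥ (1 + (U - (1 + h)⁻¹ • Matrix.vecMulVec k k)) *ᵥ w) +
          2 * ((-(√l * (1 + h)⁻¹) • k) ⬝ᵥ w)) *
        Real.exp (-((U - (1 + h)⁻¹ • Matrix.vecMulVec k k) * S).trace)) := by
    simp only [← Real.exp_add]
    congr 1
    rw [hquad, hVw, hVS, hUa, hka, smul_dotProduct, smul_eq_mul]
    field_simp
    ring
  rw [hpow]
  have hpi : (√Real.pi ^ d)⁻¹ * √Real.pi ^ d = 1 := inv_mul_cancel₀ (by positivity)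
  have hda : (√a.det)⁻¹ * √a.det = 1 := inv_mul_cancel₀ (Real.sqrt_pos.2 ha.det_pos).ne'
  have aux : ∀ A D Q R E₁ E₂ E₃ E₄ : ℝ, A⁻¹ * A = 1 → D⁻¹ * D = 1 → E₁ * E₂ = E₃ * E₄ →
      A⁻¹ * A⁻¹ * D⁻¹ * Q * E₁ * (A * (D * R) * E₂) = A⁻¹ * (Q * R) * E₃ * E₄ := by
    intro A D Q R E₁ E₂ E₃ E₄ hA hD hEE
    calc _ = (A⁻¹ * A) * (D⁻¹ * D) * (A⁻¹ * Q * R) * (E₁ * E₂) := by ring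
      _ = _ := by rw [hA, hD, hEE]; ring
  exact aux _ _ _ _ _ _ _ _ hpi hda hE

end

/-! ### Absolutely continuous non-central Wishart distributions -/

/-- `μ` is, in coordinates, an absolutely continuous measure on the positive definite matrices with
the Laplace transform of the non-central Wishart distribution `Γ(p, ω; σ)`. -/
structure IsWishartCoords {d : ℕ} (p : ℝ) (ω σ : Matrix (Fin d) (Fin d) ℝ)
    (μ : Measure (SymCoords d)) : Prop where
  absolutelyContinuous : μ ≪ volume
  posDef : ∀ᵐ v ∂μ, (symMatrix d v).PosDef
  laplace : ∀ u : Matrix (Fin d) (Fin d) ℝ, u.PosSemidef →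
    ∫⁻ v, ENNReal.ofReal (Real.exp (-(u * symMatrix d v).trace)) ∂μ =
      ENNReal.ofReal ((1 + σ * u).det ^ (-p) * Real.exp (-(u * (1 + σ * u)⁻¹ * ω).trace))

theorem measurable_exp_neg_trace_symMatrix {d : ℕ} (u : Matrix (Fin d) (Fin d) ℝ) :
    Measurable fun v => ENNReal.ofReal (Real.exp (-(u * symMatrix d v).trace)) := by
  refine ENNReal.measurable_ofReal.comp (Continuous.measurable (Real.continuous_exp.comp ?_))
  exact (continuous_const.matrix_mul (continuous_symMatrix d)).matrix_trace.neg

theorem measurableSet_symMatrix_posDef (d : ℕ) :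
    MeasurableSet {v : SymCoords d | (symMatrix d v).PosDef} := by
  have : {v : SymCoords d | (symMatrix d v).PosDef} =
      symMatrix d ⁻¹' {x | x.PosSemidef} ∩ {v | (symMatrix d v).det ≠ 0} := by
    ext v
    exact ⟨fun h => ⟨h.posSemidef, h.det_pos.ne'⟩, fun h => h.1.posDef_iff_det_ne_zero.2 h.2⟩
  rw [this]
  refine ((PSDCone.isClosed_setOf_posSemidef d).preimage
    (continuous_symMatrix d)).measurableSet.inter ?_
  exact (isOpen_ne_fun (continuous_symMatrix d).matrix_det continuous_const).measurableSet

theorem Matrix.mul_inv_eq_inv_mul_of_mul_eq {n : Type*} [Fintype n] [DecidableEq n]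
    {g x y : Matrix n n ℝ} (hy : IsUnit y.det) (hx : IsUnit x.det) (h : y * g = g * x) :
    g * x⁻¹ = y⁻¹ * g := by
  calc g * x⁻¹ = y⁻¹ * (y * g) * x⁻¹ := by
        rw [← Matrix.mul_assoc, Matrix.nonsing_inv_mul y hy, Matrix.one_mul]
    _ = y⁻¹ * g := by
        rw [h, ← Matrix.mul_assoc, Matrix.mul_assoc, Matrix.mul_nonsing_inv x hx, Matrix.mul_one]

namespace IsWishartCoords

theorem isProbabilityMeasure {d : ℕ} {p : ℝ} {ω σ : Matrix (Fin d) (Fin d) ℝ}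
    {μ : Measure (SymCoords d)} (hμ : IsWishartCoords p ω σ μ) : IsProbabilityMeasure μ := by
  have h := hμ.laplace 0 Matrix.PosSemidef.zero
  simp only [Matrix.zero_mul, Matrix.trace_zero, neg_zero, Real.exp_zero, ENNReal.ofReal_one,
    lintegral_const, one_mul, Matrix.mul_zero, add_zero, Matrix.det_one, Real.one_rpow,
    mul_one] at h
  exact ⟨h⟩

/-- The congruence moves to the argument as `u ↦ gᵀ u g`; Sylvester's identity handles the
determinant and the push-through identity `hinv` the exponent. -/
theorem map_congrCoords {d : ℕ} {p : ℝ} {ω σ : Matrix (Fin d) (Fin d) ℝ}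
    {μ : Measure (SymCoords d)} (hμ : IsWishartCoords p ω σ μ) (g : Matrix (Fin d) (Fin d) ℝ)
    (hg : g.det ≠ 0) (hσ : σ.PosSemidef) :
    IsWishartCoords p (g * ω * gᵀ) (g * σ * gᵀ) (μ.map (congrCoords g hg)) := by
  have hq := (congrCoords g hg).quasiMeasurePreserving_addHaar volume volume
  have hgu : IsUnit g.det := isUnit_iff_ne_zero.2 hg
  refine ⟨(hμ.absolutelyContinuous.map hq.measurable).trans hq.absolutelyContinuous, ?_, ?_⟩
  · rw [ae_map_iff hq.measurable.aemeasurable (measurableSet_symMatrix_posDef d)]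
    filter_upwards [hμ.posDef] with v hv
    rw [symMatrix_congrCoords]
    have hgT : IsUnit g := (Matrix.isUnit_iff_isUnit_det g).2 hgu
    have := (Matrix.IsUnit.posDef_star_right_conjugate_iff hgT (x := symMatrix d v)).2 hv
    simpa [Matrix.star_eq_conjTranspose] using this
  · intro u hu
    have hu' : (gᵀ * u * g).PosSemidef := by simpa using hu.conjTranspose_mul_mul_same g
    rw [lintegral_map (measurable_exp_neg_trace_symMatrix u) hq.measurable]
    simp_rw [symMatrix_congrCoords]
    have htr : ∀ x : Matrix (Fin d) (Fin d) ℝ, (u * (g * x * gᵀ)).trace =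
        (gᵀ * u * g * x).trace := by
      intro x
      rw [← Matrix.mul_assoc, Matrix.trace_mul_comm]
      simp only [Matrix.mul_assoc]
    simp_rw [htr]
    rw [hμ.laplace _ hu']
    have hdet : (1 + σ * (gᵀ * u * g)).det = (1 + g * σ * gᵀ * u).det := by
      rw [show σ * (gᵀ * u * g) = (σ * gᵀ * u) * g by simp only [Matrix.mul_assoc],
        Matrix.det_one_add_mul_comm]
      simp only [Matrix.mul_assoc]
    have hne : (1 + σ * (gᵀ * u * g)).det ≠ 0 := (hσ.det_one_add_mul_pos hu').ne'
    have hinv : g * (1 + σ * (gᵀ * u * g))⁻¹ = (1 + g * σ * gᵀ * u)⁻¹ * g := by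
      have h1 : (1 + g * σ * gᵀ * u) * g = g * (1 + σ * (gᵀ * u * g)) := by
        simp only [Matrix.mul_add, Matrix.add_mul, Matrix.one_mul, Matrix.mul_one, Matrix.mul_assoc]
      have hu1 : IsUnit (1 + σ * (gᵀ * u * g)).det := isUnit_iff_ne_zero.2 hne
      have hu2 : IsUnit (1 + g * σ * gᵀ * u).det := hdet ▸ hu1
      exact Matrix.mul_inv_eq_inv_mul_of_mul_eq hu2 hu1 h1
    rw [hdet]
    congr 4
    rw [← Matrix.mul_assoc (u * _) (g * ω), Matrix.trace_mul_comm _ gᵀ]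
    congr 1
    calc gᵀ * u * g * (1 + σ * (gᵀ * u * g))⁻¹ * ω
        = gᵀ * u * (g * (1 + σ * (gᵀ * u * g))⁻¹) * ω := by simp only [Matrix.mul_assoc]
      _ = _ := by rw [hinv]; simp only [Matrix.mul_assoc]

end IsWishartCoords

/-! #### Bordering -/

/-- The inverse is the adjugate divided by the determinant; with the convention `0⁻¹ = 0` this also
holds at singular matrices. -/
theorem measurable_dotProduct_inv_mulVec {Z : Type*} [TopologicalSpace Z] [MeasurableSpace Z]
    [OpensMeasurableSpace Z] {d : ℕ} {A : Z → Matrix (Fin d) (Fin d) ℝ} {x y : Z → Fin d → ℝ}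
    (hA : Continuous A) (hx : Continuous x) (hy : Continuous y) :
    Measurable fun z => x z ⬝ᵥ (A z)⁻¹ *ᵥ y z := by
  have h : (fun z => x z ⬝ᵥ (A z)⁻¹ *ᵥ y z) =
      fun z => ((A z).det)⁻¹ * (x z ⬝ᵥ (A z).adjugate *ᵥ y z) := by
    funext z
    rw [Matrix.inv_def, Ring.inverse_eq_inv', Matrix.smul_mulVec, dotProduct_smul, smul_eq_mul]
  rw [h]
  exact hA.matrix_det.measurable.inv.mul
    (hx.dotProduct (hA.matrix_adjugate.matrix_mulVec hy)).measurable

section Border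

variable {d : ℕ}

/-- The sample space of a matrix together with the data of its border. -/
abbrev BorderSpace (d : ℕ) : Type := (((Fin d → ℝ) × SymCoords d) × (Fin d → ℝ)) × ℝ

/-- The map that sends a matrix `S`, vectors `w`, `b` and a Schur complement `s` to the coordinates
of the bordered matrix with upper left block `S + w wᵀ` and off-diagonal part `b`. -/
noncomputable def borderMap (d : ℕ) (z : BorderSpace d) : SymCoords (d + 1) :=
  borderedCoords d ((z.1.1.2 + symCoords d (Matrix.vecMulVec z.1.1.1 z.1.1.1), z.1.2),
    z.1.2 ⬝ᵥ (symMatrix d (z.1.1.2 + symCoords d (Matrix.vecMulVec z.1.1.1 z.1.1.1)))⁻¹ *ᵥ z.1.2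
      + z.2)

theorem symMatrix_add_vecMulVec (v : SymCoords d) (w : Fin d → ℝ) :
    symMatrix d (v + symCoords d (Matrix.vecMulVec w w)) =
      symMatrix d v + Matrix.vecMulVec w w := by
  rw [map_add, symMatrix_symCoords (Matrix.transpose_vecMulVec w w)]

theorem symMatrix_borderMap (w b : Fin d → ℝ) (v : SymCoords d) (s : ℝ) :
    symMatrix (d + 1) (borderMap d (((w, v), b), s)) =
      borderedMatrix (symMatrix d v + Matrix.vecMulVec w w) b
        (b ⬝ᵥ (symMatrix d v + Matrix.vecMulVec w w)⁻¹ *ᵥ b + s) := by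
  rw [borderMap, symMatrix_borderedCoords]
  simp only [symMatrix_add_vecMulVec]

/-- The map is composed of a translation of `S` for fixed `w`, after which `w` is forgotten, a
translation of the corner for fixed `a` and `b`, and the linear isomorphism `borderedCoords`. -/
theorem quasiMeasurePreserving_borderMap (d : ℕ) :
    Measure.QuasiMeasurePreserving (borderMap d) (volume : Measure (BorderSpace d)) volume := by
  have hshift : Measure.QuasiMeasurePreserving
      (fun z : (Fin d → ℝ) × SymCoords d => z.2 + symCoords d (Matrix.vecMulVec z.1 z.1))
      volume volume := by
    have hc : Continuous fun z : (Fin d → ℝ) × SymCoords d =>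
        z.2 + symCoords d (Matrix.vecMulVec z.1 z.1) :=
      continuous_snd.add ((continuous_symCoords d).comp
        (continuous_fst.matrix_vecMulVec continuous_fst))
    have h := MeasurePreserving.skew_product (μa := (volume : Measure (Fin d → ℝ)))
      (μc := (volume : Measure (SymCoords d))) (μd := volume) (MeasurePreserving.id _)
      (g := fun w v => v + symCoords d (Matrix.vecMulVec w w)) hc.measurable
      (Filter.Eventually.of_forall fun w => map_add_right_eq_self volume _)
    exact Measure.quasiMeasurePreserving_snd.comp h.quasiMeasurePreserving
  have hshear : MeasurePreserving (fun z : (SymCoords d × (Fin d → ℝ)) × ℝ =>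
      (z.1, z.1.2 ⬝ᵥ (symMatrix d z.1.1)⁻¹ *ᵥ z.1.2 + z.2)) volume volume := by
    have hm : Measurable fun z : SymCoords d × (Fin d → ℝ) =>
        z.2 ⬝ᵥ (symMatrix d z.1)⁻¹ *ᵥ z.2 :=
      measurable_dotProduct_inv_mulVec ((continuous_symMatrix d).comp continuous_fst)
        continuous_snd continuous_snd
    exact MeasurePreserving.skew_product (μc := (volume : Measure ℝ)) (μd := volume)
      (MeasurePreserving.id _)
      (g := fun (z : SymCoords d × (Fin d → ℝ)) s => z.2 ⬝ᵥ (symMatrix d z.1)⁻¹ *ᵥ z.2 + s)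
      ((hm.comp measurable_fst).add measurable_snd)
      (Filter.Eventually.of_forall fun z => map_add_left_eq_self volume _)
  have hprod := QuasiMeasurePreserving.prodMap (QuasiMeasurePreserving.prodMap hshift
    (Measure.QuasiMeasurePreserving.id (volume : Measure (Fin d → ℝ))))
    (Measure.QuasiMeasurePreserving.id (volume : Measure ℝ))
  have : (volume : Measure (SymCoords d × (Fin d → ℝ))).IsAddHaarMeasure :=
    Measure.prod.instIsAddHaarMeasure _ _
  have : (volume : Measure ((SymCoords d × (Fin d → ℝ)) × ℝ)).IsAddHaarMeasure :=
    Measure.prod.instIsAddHaarMeasure _ _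
  exact ((borderedCoords d).quasiMeasurePreserving_addHaar volume volume).comp
    (hshear.quasiMeasurePreserving.comp hprod)

theorem measurable_borderDensity (q l : ℝ) :
    Measurable fun z : BorderSpace d =>
      borderDensity q l (symMatrix d z.1.1.2) z.1.1.1 z.1.2 z.2 := by
  have hw : Continuous fun z : BorderSpace d => z.1.1.1 := by fun_prop
  have hb : Continuous fun z : BorderSpace d => z.1.2 := by fun_prop
  have hv : Continuous fun z : BorderSpace d => z.1.1.2 := by fun_prop
  have hA : Continuous fun z : BorderSpace d =>
      symMatrix d z.1.1.2 + Matrix.vecMulVec z.1.1.1 z.1.1.1 :=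
    ((continuous_symMatrix d).comp hv).add (hw.matrix_vecMulVec hw)
  have hbw : Continuous fun z : BorderSpace d => z.1.2 - √l • z.1.1.1 := by
    fun_prop
  refine Measurable.fun_mul (ENNReal.measurable_ofReal.comp ?_) ?_
  · refine Measurable.fun_mul ?_ (Measurable.fun_mul (Measurable.fun_mul measurable_const ?_) ?_)
    · exact (continuous_const.mul (Real.continuous_exp.comp (hw.dotProduct hw).neg)).measurable
    · exact (Real.continuous_sqrt.comp hA.matrix_det).measurable.inv
    · exact Real.measurable_exp.comp (measurable_dotProduct_inv_mulVec hA hbw hbw).neg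
  · exact (measurable_noncentralGammaPDF q).comp
      (((measurable_dotProduct_inv_mulVec hA hw hw).const_sub 1).const_mul l |>.prodMk
        measurable_snd)

/-- In the transform, the Gaussian integral over `w` contributes `det (1 + V) ^ (-1/2)`, where `V`
is the Schur complement matrix; this raises the parameter `p - 1/2` of `μ` to `p`. The border
contributes `(1 + h) ^ (-p)`. -/
theorem IsWishartCoords.border {p l : ℝ} {ω : Matrix (Fin d) (Fin d) ℝ}
    {μ : Measure (SymCoords d)} (hμ : IsWishartCoords (p - 1 / 2) ω 1 μ) (hp : (d : ℝ) / 2 < p)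
    (hl : 0 ≤ l) :
    ∃ ν : Measure (SymCoords (d + 1)), IsWishartCoords p (borderedMatrix ω 0 l) 1 ν := by
  have := hμ.isProbabilityMeasure
  let ρ : Measure (BorderSpace d) :=
    (((volume : Measure (Fin d → ℝ)).prod μ).prod volume).prod volume
  have hρ : ρ ≪ volume :=
    ((Measure.AbsolutelyContinuous.rfl.prod hμ.absolutelyContinuous).prod
      Measure.AbsolutelyContinuous.rfl).prod Measure.AbsolutelyContinuous.rfl
  let f : BorderSpace d → ℝ≥0∞ := fun z =>
    borderDensity (p - d / 2) l (symMatrix d z.1.1.2) z.1.1.1 z.1.2 z.2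
  have hf : Measurable f := measurable_borderDensity _ _
  have hT := quasiMeasurePreserving_borderMap d
  have hpd : ∀ᵐ z ∂ρ, (symMatrix d z.1.1.2).PosDef :=
    (Measure.quasiMeasurePreserving_snd.comp (Measure.quasiMeasurePreserving_fst.comp
      Measure.quasiMeasurePreserving_fst)).ae hμ.posDef
  refine ⟨(ρ.withDensity f).map (borderMap d), ?_, ?_, ?_⟩
  · exact (((withDensity_absolutelyContinuous ρ f).trans hρ).map hT.measurable).trans
      hT.absolutelyContinuous
  · rw [ae_map_iff hT.measurable.aemeasurable (measurableSet_symMatrix_posDef (d + 1)),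
      ae_withDensity_iff hf]
    -- The density vanishes for `s < 0`, but positive definiteness needs `s > 0`, so the null set `s
    -- = 0` is discarded.
    have hne : ∀ᵐ z ∂ρ, z.2 ≠ 0 := by
      have : ∀ᵐ s : ℝ, s ≠ 0 := by simp [ae_iff]
      exact (Measure.quasiMeasurePreserving_snd (μ := ((volume : Measure (Fin d → ℝ)).prod μ).prod
        (volume : Measure (Fin d → ℝ))) (ν := (volume : Measure ℝ))).ae this
    filter_upwards [hpd, hne] with z hz hz0 hfz
    obtain ⟨⟨⟨w, v⟩, b⟩, s⟩ := z
    rw [symMatrix_borderMap]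
    refine borderedMatrix_posDef (hz.add_posSemidef (vecMulVec_self_posSemidef w)) b ?_
    refine lt_of_le_of_ne (not_lt.1 fun hs => hfz ?_) (Ne.symm hz0)
    change _ * noncentralGammaPDF _ _ s = 0
    rw [noncentralGammaPDF_of_neg _ _ hs, mul_zero]
  · intro u hu
    obtain ⟨U, k, h, rfl⟩ : ∃ U k h, u = borderedMatrix U k h :=
      ⟨_, _, _, eq_borderedMatrix (by simpa using hu.1.eq)⟩
    have hh := borderedMatrix_posSemidef_corner hu
    have hpos : 0 < 1 + h := by positivity
    have hV := borderedMatrix_posSemidef_schur hu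
    have hLm := measurable_exp_neg_trace_symMatrix (borderedMatrix U k h)
    have hfL : Measurable fun z => f z * ENNReal.ofReal (Real.exp
        (-(borderedMatrix U k h * symMatrix (d + 1) (borderMap d z)).trace)) :=
      hf.fun_mul (hLm.comp hT.measurable)
    rw [lintegral_map hLm hT.measurable,
      lintegral_withDensity_eq_lintegral_mul _ hf (g := fun z => ENNReal.ofReal (Real.exp
        (-(borderedMatrix U k h * symMatrix (d + 1) (borderMap d z)).trace)))
        (hLm.comp hT.measurable)]
    have hTon : ∫⁻ z, (f * fun z => ENNReal.ofReal (Real.exp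
        (-(borderedMatrix U k h * symMatrix (d + 1) (borderMap d z)).trace))) z ∂ρ =
        ∫⁻ y, (∫⁻ b, ∫⁻ s, f ((y, b), s) * ENNReal.ofReal (Real.exp (-(borderedMatrix U k h *
          symMatrix (d + 1) (borderMap d ((y, b), s))).trace)))
          ∂(volume : Measure (Fin d → ℝ)).prod μ := by
      simp only [Pi.mul_apply]
      rw [lintegral_prod _ hfL.aemeasurable,
        lintegral_prod _ hfL.lintegral_prod_right'.aemeasurable]
    have hpd' : ∀ᵐ y ∂((volume : Measure (Fin d → ℝ)).prod μ), (symMatrix d y.2).PosDef :=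
      Measure.quasiMeasurePreserving_snd.ae hμ.posDef
    have hq : 0 < p - d / 2 := by linarith
    -- The inner integral is known only for positive definite `S`, so the integrand is replaced
    -- almost everywhere.
    rw [hTon, lintegral_congr_ae (g := fun y => ENNReal.ofReal ((√Real.pi ^ d)⁻¹ *
        (1 + h) ^ (-(p - d / 2 + d / 2)) * Real.exp (-(h / (1 + h) * l))) *
      (ENNReal.ofReal (Real.exp (-(y.1 ⬝ᵥ (1 + (U - (1 + h)⁻¹ • Matrix.vecMulVec k k)) *ᵥ y.1) +
          2 * ((-(√l * (1 + h)⁻¹) • k) ⬝ᵥ y.1))) *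
        ENNReal.ofReal (Real.exp (-((U - (1 + h)⁻¹ • Matrix.vecMulVec k k) *
          symMatrix d y.2).trace)))) ?_]
    · have hm1 : Measurable fun w : Fin d → ℝ => ENNReal.ofReal (Real.exp
          (-(w ⬝ᵥ (1 + (U - (1 + h)⁻¹ • Matrix.vecMulVec k k)) *ᵥ w) +
          2 * ((-(√l * (1 + h)⁻¹) • k) ⬝ᵥ w))) := by
        refine ENNReal.measurable_ofReal.comp (Continuous.measurable (Real.continuous_exp.comp ?_))
        exact ((continuous_id.dotProduct (continuous_const.matrix_mulVec continuous_id)).neg).add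
          (continuous_const.mul (continuous_const.dotProduct continuous_id))
      have hm2 := measurable_exp_neg_trace_symMatrix (U - (1 + h)⁻¹ • Matrix.vecMulVec k k)
      have hY := Matrix.PosDef.one.add_posSemidef hV
      have hm12 : Measurable fun y : (Fin d → ℝ) × SymCoords d => ENNReal.ofReal (Real.exp
          (-(y.1 ⬝ᵥ (1 + (U - (1 + h)⁻¹ • Matrix.vecMulVec k k)) *ᵥ y.1) +
          2 * ((-(√l * (1 + h)⁻¹) • k) ⬝ᵥ y.1))) * ENNReal.ofReal (Real.exp
          (-((U - (1 + h)⁻¹ • Matrix.vecMulVec k k) * symMatrix d y.2).trace)) :=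
        (hm1.comp measurable_fst).fun_mul (hm2.comp measurable_snd)
      rw [lintegral_const_mul _ hm12,
        lintegral_prod_mul hm1.aemeasurable hm2.aemeasurable, lintegral_exp_neg_quadratic hY,
        hμ.laplace _ hV, Matrix.one_mul, Matrix.one_mul, trace_mul_inv_one_add_borderedMatrix hu,
        det_one_add_borderedMatrix hh, Fintype.card_fin]
      rw [← ENNReal.ofReal_mul (by have := Real.sqrt_nonneg; positivity),
        ← ENNReal.ofReal_mul (by positivity)]
      congr 1
      set V := U - (1 + h)⁻¹ • Matrix.vecMulVec k k with hV_def
      have hdet := hY.det_pos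
      have hlsq : √l ^ 2 = l := Real.sq_sqrt hl
      have hquad : (-(√l * (1 + h)⁻¹) • k) ⬝ᵥ (1 + V)⁻¹ *ᵥ (-(√l * (1 + h)⁻¹) • k) =
          l * ((1 + h)⁻¹ ^ 2 * (k ⬝ᵥ (1 + V)⁻¹ *ᵥ k)) := by
        rw [Matrix.mulVec_smul, smul_dotProduct, dotProduct_smul, smul_eq_mul, smul_eq_mul]
        linear_combination ((1 + h)⁻¹ ^ 2 * (k ⬝ᵥ (1 + V)⁻¹ *ᵥ k)) * hlsq
      have hE : Real.exp (-(h / (1 + h) * l)) * Real.exp ((-(√l * (1 + h)⁻¹) • k) ⬝ᵥ (1 + V)⁻¹ *ᵥ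
          (-(√l * (1 + h)⁻¹) • k)) * Real.exp (-(V * (1 + V)⁻¹ * ω).trace) =
          Real.exp (-((V * (1 + V)⁻¹ * ω).trace + l * (h / (1 + h) - (1 + h)⁻¹ ^ 2 *
            (k ⬝ᵥ (1 + V)⁻¹ *ᵥ k)))) := by
        simp only [← Real.exp_add]
        congr 1
        rw [hquad]
        ring
      have hD : (√(1 + V).det)⁻¹ * (1 + V).det ^ (-(p - 1 / 2)) = (1 + V).det ^ (-p) := by
        rw [Real.sqrt_eq_rpow, ← Real.rpow_neg hdet.le, ← Real.rpow_add hdet]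
        congr 1
        ring
      have hpi : (√Real.pi ^ d)⁻¹ * √Real.pi ^ d = 1 := inv_mul_cancel₀ (by positivity)
      rw [Real.mul_rpow hpos.le hdet.le, ← hE, ← hD, sub_add_cancel]
      have aux : ∀ A H E₁ D E₂ D' E₃ : ℝ, A⁻¹ * A = 1 →
          A⁻¹ * H * E₁ * (A * D * E₂ * (D' * E₃)) = H * (D * D') * (E₁ * E₂ * E₃) := by
        intro A H E₁ D E₂ D' E₃ hA
        calc _ = (A⁻¹ * A) * (H * (D * D') * (E₁ * E₂ * E₃)) := by ring
          _ = _ := by rw [hA, one_mul]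
      exact aux _ _ _ _ _ _ _ hpi
    · filter_upwards [hpd'] with y hy
      obtain ⟨w, v⟩ := y
      rw [← lintegral_borderDensity_mul_exp hq hl hu hy]
      simp only [symMatrix_borderMap, f]

end Border

/-! #### Existence -/

/-- The coordinate space is a single point of volume one, and empty determinants are one. -/
theorem isWishartCoords_fin_zero (p : ℝ) (ω : Matrix (Fin 0) (Fin 0) ℝ) :
    IsWishartCoords p ω 1 (volume : Measure (SymCoords 0)) := by
  have hprob : IsProbabilityMeasure (volume : Measure (SymCoords 0)) := by
    have : IsEmpty {q : Fin 0 × Fin 0 // q.1 ≤ q.2} := ⟨fun q => q.1.1.elim0⟩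
    rw [volume_pi, Measure.pi_of_empty (x := fun a => isEmptyElim a)]
    infer_instance
  refine ⟨Measure.AbsolutelyContinuous.rfl, Filter.Eventually.of_forall fun v => ?_, fun u _ => ?_⟩
  · rw [Subsingleton.elim (symMatrix 0 v) 1]
    exact Matrix.PosDef.one
  · simp

/-- An orthogonal congruence fixes `σ = 1` and diagonalises `ω`, so its last row and column are zero
off the diagonal. The bound `p > d/2` in dimension `d + 1` is exactly the bound for `p - 1/2` in
dimension `d`. -/
theorem exists_isWishartCoords_one (d : ℕ) : ∀ (p : ℝ) (ω : Matrix (Fin d) (Fin d) ℝ),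
    ((d : ℝ) - 1) / 2 < p → ω.PosSemidef →
    ∃ μ : Measure (SymCoords d), IsWishartCoords p ω 1 μ := by
  induction d with
  | zero => exact fun p ω _ _ => ⟨_, isWishartCoords_fin_zero p ω⟩
  | succ d ih =>
    intro p ω hp hω
    push_cast at hp
    let O : Matrix (Fin (d + 1)) (Fin (d + 1)) ℝ := hω.1.eigenvectorUnitary
    have hO : O * Oᵀ = 1 := by
      have := (Matrix.mem_unitaryGroup_iff (A := O)).1 hω.1.eigenvectorUnitary.2
      simpa [Matrix.star_eq_conjTranspose] using this
    have hspec : O * Matrix.diagonal hω.1.eigenvalues * Oᵀ = ω := by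
      have := hω.1.spectral_theorem
      rw [Unitary.conjStarAlgAut_apply] at this
      simpa [Matrix.star_eq_conjTranspose] using this.symm
    have hO0 : O.det ≠ 0 := by
      intro h0
      have := congrArg Matrix.det hO
      rw [Matrix.det_mul, h0, zero_mul, Matrix.det_one] at this
      exact zero_ne_one this
    let ω' : Matrix (Fin d) (Fin d) ℝ := Matrix.diagonal fun i => hω.1.eigenvalues i.castSucc
    obtain ⟨μ, hμ⟩ := ih (p - 1 / 2) ω' (by linarith)
      (Matrix.PosSemidef.diagonal fun i => hω.eigenvalues_nonneg _)
    obtain ⟨ν, hν⟩ := hμ.border (p := p) (l := hω.1.eigenvalues (Fin.last d)) (by linarith)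
      (hω.eigenvalues_nonneg _)
    have hdiag : borderedMatrix ω' 0 (hω.1.eigenvalues (Fin.last d)) =
        Matrix.diagonal hω.1.eigenvalues := by
      refine matrix_succ_ext (fun i j => ?_) (fun i => ?_) (fun j => ?_) ?_
      · simp [ω', Matrix.diagonal_apply]
      · simp [(Fin.castSucc_lt_last i).ne]
      · simp [(Fin.castSucc_lt_last j).ne']
      · simp
    have := hν.map_congrCoords O hO0 Matrix.PosSemidef.one
    rw [hdiag, hspec, Matrix.mul_one, hO] at this
    exact ⟨_, this⟩

/-- Congruence by the root `g` of `σ` carries the case `σ = 1` with matrix `g⁻¹ ω g⁻¹` to the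
general one. -/
theorem exists_isWishartCoords {d : ℕ} {p : ℝ} (hp : ((d : ℝ) - 1) / 2 < p)
    {ω σ : Matrix (Fin d) (Fin d) ℝ} (hω : ω.PosSemidef) (hσ : σ.PosDef) :
    ∃ μ : Measure (SymCoords d), IsWishartCoords p ω σ μ := by
  obtain ⟨g, hg, rfl⟩ := hσ.posSemidef.exists_mul_self
  have hgT : gᵀ = g := by simpa using hg.1.eq
  have hg0 : g.det ≠ 0 := by
    intro h
    have := hσ.det_pos
    rw [Matrix.det_mul, h, zero_mul] at this
    exact lt_irrefl _ this
  have hu : IsUnit g.det := isUnit_iff_ne_zero.2 hg0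
  have hiT : g⁻¹ᵀ = g⁻¹ := by rw [Matrix.transpose_nonsing_inv, hgT]
  have hω' : (g⁻¹ * ω * g⁻¹).PosSemidef := by
    have := hω.mul_mul_conjTranspose_same g⁻¹
    rwa [Matrix.conjTranspose_eq_transpose_of_trivial, hiT] at this
  obtain ⟨μ, hμ⟩ := exists_isWishartCoords_one d p _ hp hω'
  have h := hμ.map_congrCoords g hg0 Matrix.PosSemidef.one
  have h1 : g * (g⁻¹ * ω * g⁻¹) * gᵀ = ω := by
    rw [hgT, ← Matrix.mul_assoc, ← Matrix.mul_assoc, Matrix.mul_nonsing_inv g hu, Matrix.one_mul,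
      Matrix.mul_assoc, Matrix.nonsing_inv_mul g hu, Matrix.mul_one]
  rw [h1, Matrix.mul_one, hgT] at h
  exact ⟨_, h⟩

/-! ### Absolute continuity on the cone -/

theorem measurableEmbedding_psdCone_val (d : ℕ) :
    MeasurableEmbedding (Subtype.val : PSDCone d → Matrix (Fin d) (Fin d) ℝ) :=
  MeasurableEmbedding.subtype_coe (PSDCone.isClosed_setOf_posSemidef d).measurableSet

instance sigmaFinite_lebesgueCone (d : ℕ) : SigmaFinite (lebesgueCone d) := by
  have : SigmaFinite ((volume : Measure (SymCoords d)).map (symmetricOfCoords d)) :=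
    (measurableEmbedding_symMatrix d).sigmaFinite_map
  have hval := measurableEmbedding_psdCone_val d
  refine SigmaFinite.of_map _ hval.measurable.aemeasurable ?_
  rw [lebesgueCone, hval.map_comap]
  infer_instance

/-- For `p > (d - 1) / 2` and positive definite `σ` the non-central Wishart distribution
`Γ(p, ω; σ)` exists and is absolutely continuous. -/
theorem exists_isNoncentralWishart_absolutelyContinuous {d : ℕ} {p : ℝ}
    (hp : ((d : ℝ) - 1) / 2 < p) (ω : PSDCone d) {σ : PSDCone d} (hσ : σ.1.PosDef) :
    ∃ ν, IsNoncentralWishart p ω σ ν ∧ ν ≪ lebesgueCone d := by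
  obtain ⟨μ, hμ⟩ := exists_isWishartCoords hp ω.2 hσ
  have hval := measurableEmbedding_psdCone_val d
  have hsym := measurableEmbedding_symMatrix d
  let ν : Measure (PSDCone d) := (μ.map (symMatrix d)).comap Subtype.val
  -- The measure is carried by the cone, so pulling it back loses no mass.
  have hmem : ∀ᵐ x ∂(μ.map (symMatrix d)),
      x ∈ Set.range (Subtype.val : PSDCone d → Matrix (Fin d) (Fin d) ℝ) := by
    rw [hsym.ae_map_iff]
    filter_upwards [hμ.posDef] with v hv
    exact ⟨⟨_, hv.posSemidef⟩, rfl⟩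
  have hmap : ν.map Subtype.val = μ.map (symMatrix d) := by
    rw [hval.map_comap, Measure.restrict_eq_self_of_ae_mem hmem]
  have hlap : ∀ u : PSDCone d, ∫⁻ ξ, ENNReal.ofReal (Real.exp (-(u.pairing ξ))) ∂ν =
      ENNReal.ofReal ((1 + σ.1 * u.1).det ^ (-p) *
        Real.exp (-(u.1 * (1 + σ.1 * u.1)⁻¹ * ω.1).trace)) := by
    intro u
    rw [← hμ.laplace u.1 u.2]
    have h1 := hval.lintegral_map (μ := ν)
      (fun x => ENNReal.ofReal (Real.exp (-(u.1 * x).trace)))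
    rw [hmap, hsym.lintegral_map] at h1
    exact h1.symm
  refine ⟨ν, ⟨⟨?_⟩, fun u => ?_⟩, ?_⟩
  · have h := hlap ⟨0, Matrix.PosSemidef.zero⟩
    simpa [PSDCone.pairing] using h
  · rw [integral_eq_lintegral_of_nonneg_ae
      (Filter.Eventually.of_forall fun _ => (Real.exp_pos _).le)
      (PSDCone.expNegPairing u).continuous.aestronglyMeasurable, hlap, ENNReal.toReal_ofReal]
    have := σ.2.det_one_add_mul_pos u.2
    positivity
  · intro s hs
    rw [lebesgueCone, hval.comap_apply] at hs
    rw [hval.comap_apply]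
    exact hsym.absolutelyContinuous_map hμ.absolutelyContinuous hs

/-! ### Positive definiteness of the flow and of the scale matrix. -/

section

attribute [local instance] Matrix.linftyOpNormedRing Matrix.linftyOpNormedAlgebra

theorem wishartFlow_posDef {d : ℕ} (β : Matrix (Fin d) (Fin d) ℝ) (t : ℝ) {x : PSDCone d}
    (hx : x.1.PosDef) : (wishartFlow β t x).1.PosDef := by
  rw [(wishartFlow β t x).2.posDef_iff_det_ne_zero]
  have hdet : ∀ b : Matrix (Fin d) (Fin d) ℝ, (NormedSpace.exp b).det ≠ 0 := fun b =>
    ((Matrix.isUnit_iff_isUnit_det _).1 (Matrix.isUnit_exp b)).ne_zero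
  simp only [wishartFlow, Matrix.det_mul]
  exact mul_ne_zero (mul_ne_zero (hdet _) hx.det_pos.ne') (hdet _)

/-- For `v ≠ 0` the form `v · Σ_t v` starts at zero and has derivative `2 v · ω_t v > 0`. -/
theorem wishartScale_posDef {d : ℕ} (β : Matrix (Fin d) (Fin d) ℝ) {t : ℝ≥0} (ht : 0 < t)
    {x : PSDCone d} (hx : x.1.PosDef) : (wishartScale β t x).1.PosDef := by
  refine Matrix.PosDef.of_dotProduct_mulVec_pos (wishartScale β t x).2.1 fun v hv => ?_
  rw [star_trivial]
  let L : Matrix (Fin d) (Fin d) ℝ →ₗ[ℝ] ℝ :=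
    { toFun := fun a => v ⬝ᵥ a *ᵥ v
      map_add' := fun a b => by rw [Matrix.add_mulVec, dotProduct_add]
      map_smul' := fun r a => by rw [Matrix.smul_mulVec, dotProduct_smul, RingHom.id_apply] }
  have hderiv : ∀ s, HasDerivAt (fun r => L (integratedFlow β x r))
      (L ((2 : ℝ) • (wishartFlow β s x).1)) s := fun s =>
    L.toContinuousLinearMap.hasFDerivAt.comp_hasDerivAt s (hasDerivAt_integratedFlow β x s)
  have hpos : ∀ s, 0 < L ((2 : ℝ) • (wishartFlow β s x).1) := fun s => by
    have := (wishartFlow_posDef β s hx).dotProduct_mulVec_pos hv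
    rw [star_trivial] at this
    rw [map_smul, smul_eq_mul]
    exact mul_pos two_pos this
  have hmono : StrictMono fun r => L (integratedFlow β x r) :=
    strictMono_of_hasDerivAt_pos hderiv hpos
  have := hmono (show (0 : ℝ) < t from ht)
  simp only [integratedFlow_zero, map_zero] at this
  exact this

end

theorem proposition7 {d : ℕ} {Ω : Type*} [mΩ : MeasurableSpace Ω]
    (ℱ : Filtration ℝ≥0 mΩ) (X : ℝ≥0 → Ω → PSDCone d) (P : PSDCone d → Measure Ω)
    (p : ℝ) (α : PSDCone d) (β : Matrix (Fin d) (Fin d) ℝ)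
    (hX : IsWishartProcess ℱ X P p α β) (hα : α.1 ≠ 0) :
    (∀ t : ℝ≥0, 0 < t → ∀ x : PSDCone d,
      IsNoncentralWishart p (wishartFlow β t x) (wishartScale β t α) ((P x).map (X t)) ∧
      (P x).map (X t) = noncentralWishart p (wishartFlow β t x) (wishartScale β t α)) ∧
    (α.1.PosDef → ((d : ℝ) - 1) / 2 < p → ∀ t : ℝ≥0, 0 < t → ∀ x : PSDCone d,
      (P x).map (X t) = (lebesgueCone d).withDensity
        fun ξ => wishartDensity p (wishartFlow β t x) (wishartScale β t α) ξ) := by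
  refine ⟨fun t _ x => ⟨hX.isNoncentralWishart t x,
    (hX.isNoncentralWishart t x).eq_noncentralWishart⟩, fun hαpos hp t ht x => ?_⟩
  -- Uniqueness identifies the law with the constructed `ν`, and Radon-Nikodym recovers `ν` from its
  -- density.
  obtain ⟨ν, hν, hac⟩ := exists_isNoncentralWishart_absolutelyContinuous hp (wishartFlow β t x)
    (wishartScale_posDef β ht hαpos)
  rw [(hX.isNoncentralWishart t x).unique hν]
  have := hν.isProbabilityMeasure
  unfold wishartDensity
  rw [← hν.eq_noncentralWishart]
  exact (Measure.withDensity_rnDeriv_eq ν (lebesgueCone d) hac).symm
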